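/- Let $\mathcal Q=\bigoplus_{n\ge 0}\mathcal Q_n$ be the graded Hopf algebra of quasisymmetric functions over $\mathbb Q$, with the monomial basis $M_\alpha=\sum_{i_1<\dots<i_k}x_{i_1}^{a_1}\cdots x_{i_k}^{a_k}$ and the fundamental basis $F_\alpha=\sum_{\beta\ge\alpha}M_\beta$ (the sum over the refinements $\beta$ of $\alpha$), where $\alpha=(a_1,\dots,a_k)$ runs over all compositions, with product the product of power series and coproduct $\Delta(M_\alpha)=\sum_{\alpha=\beta\cdot\gamma}M_\beta\otimes M_\gamma$. Let $X:\mathcal Q\to\mathbb Q$ be the universal character, with $X(M_\alpha)=1$ if $\alpha$ has at most one part and $X(M_\alpha)=0$ otherwise, and let $X\star X$ be the convolution square, $(X\star X)(M_\alpha)=\sum_{\alpha=\beta\cdot\gamma}X(M_\beta)X(M_\gamma)$. There is a unique degree-preserving Hopf algebra endomorphism $\Psi_2$ of $\mathcal Q$ with $X\circ\Psi_2=X\star X$. For a finite graded poset $P$ with $\hat 0$, $\hat 1$ and rank differences $\rho(s,t)$, let $$F(P)=\sum_{\hat 0=t_0<t_1<\dots<t_k=\hat 1}M_{(\rho(t_0,t_1),\dots,\rho(t_{k-1},t_k))},$$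 the sum over all chains in $P$ from $\hat 0$ to $\hat 1$. There is a unique linear functional $G$ on $\mathcal Q$ with $G(F(P))=\#P$ for every such $P$, and $G$ is multiplicative. The Tchebyshev operator of the second kind is the linear operator $U$ on $\mathcal Q$, existing and uniquely determined, such that for every finite graded poset $P$ with $\hat 0$ and $\hat 1$ $$U(F(P))=\sum_{\hat 0=t_0<t_1<\dots<t_k=\hat 1}G(F([t_0,t_1]))\cdots G(F([t_{k-1},t_k]))\,M_{(\rho(t_0,t_1),\dots,\rho(t_{k-1},t_k))}.$$ Then $U=\Psi_2$. Moreover, for all $n,k\ge 0$ and every composition $\alpha$ of $n$, the coefficient of $F_\alpha$ in the expansion of $\frac{1}{2^{nk}}U^k(F_{(n)})$ in the fundamental basis (with $F_{(0)}=F_{()}=1$) equals the probability that a deck of $n$ cards, initially in the order $1,2,\dots,n$, is after $k$ independent riffle shuffles in an arrangement $\sigma=(\sigma_1,\dots,\sigma_n)$ (with card $\sigma_i$ in position $i$) whose descent composition is $\alpha$. The descent composition of $\sigma$ is the composition of $n$ whose set of proper partial sums is $\{i:\sigma_i>\sigma_{i+1}\}$. A riffle shuffle follows the Gilbert–Shannon–Reeds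 model: cut off the top $c$ cards with probability $\binom nc/2^n$, then let the cards fall one at a time from the bottoms of the two packets onto a new pile, the next card falling from a given packet with probability proportional to the current size of that packet. -/

import Mathlib

noncomputable section

open scoped TensorProduct

/-! ### Quasisymmetric functions

Power series are taken over `ℚ` in the variables `x 0, x 1, x 2, …`. -/

/-- The exponents of the monomial `x ^ m`, listed in increasing order of the indices of the
variables that occur in it.  For `m = x_{i₁}^{a₁} ⋯ x_{i_k}^{a_k}` with `i₁ < ⋯ < i_k` and all
`a_j > 0` this is the list `[a₁, …, a_k]`. -/
def exponentWord (m : ℕ →₀ ℕ) : List ℕ := m.support.sort.map m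

/-- The monomial quasisymmetric function `M_α = ∑_{i₁ < ⋯ < i_k} x_{i₁}^{a₁} ⋯ x_{i_k}^{a_k}`,
as a power series. -/
def monomialSeries {n : ℕ} (α : Composition n) : MvPowerSeries ℕ ℚ :=
  fun m => if exponentWord m = α.blocks then 1 else 0

/-- The monomial `x_0^{a₁} ⋯ x_{k-1}^{a_k}`. -/
def packedMonomial (l : List ℕ) : ℕ →₀ ℕ := l.toFinsupp

/-- An increasing enumeration that starts with the elements of `s`. -/
def spread (s : Finset ℕ) : ℕ → ℕ := fun i =>
  if h : i < s.card then s.orderEmbOfFin rfl ⟨i, h⟩ else s.sup id + 1 + i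

theorem spread_strictMono (s : Finset ℕ) : StrictMono (spread s) := by
  intro i j hij
  unfold spread
  split_ifs with h1 h2 h2
  · exact (s.orderEmbOfFin rfl).strictMono hij
  · have := Finset.le_sup (f := id) (s.orderEmbOfFin_mem rfl ⟨i, h1⟩)
    simp only [id] at this
    omega
  · omega
  · omega

theorem exponentWord_pos (m : ℕ →₀ ℕ) : ∀ a ∈ exponentWord m, 0 < a := by
  intro a ha
  simp only [exponentWord, List.mem_map, Finset.mem_sort, Finsupp.mem_support_iff] at ha
  obtain ⟨i, hi, rfl⟩ := ha
  omega

theorem exponentWord_sum (m : ℕ →₀ ℕ) : (exponentWord m).sum = m.degree := by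
  rw [exponentWord, ← Multiset.sum_coe, ← Multiset.map_coe, Finset.sort_eq]
  rfl

theorem exponentWord_embDomain (e : ℕ ↪ ℕ) (he : StrictMono e) (m : ℕ →₀ ℕ) :
    exponentWord (m.embDomain e) = exponentWord m := by
  have hs : (m.support.map e).sort = m.support.sort.map e := by
    refine List.Perm.eq_of_pairwise' (r := (· ≤ ·)) (Finset.pairwise_sort _ _) ?_ ?_
    · rw [List.pairwise_map]
      exact (Finset.pairwise_sort _ _).imp fun h => he.monotone h
    · rw [← Multiset.coe_eq_coe, Finset.sort_eq, ← Multiset.map_coe, Finset.sort_eq,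
        Finset.map_val]
  rw [exponentWord, Finsupp.support_embDomain, hs, List.map_map, exponentWord]
  exact List.map_congr_left fun i _ => Finsupp.embDomain_apply_self e m i

theorem embDomain_packedMonomial (m : ℕ →₀ ℕ) :
    (packedMonomial (exponentWord m)).embDomain
      ⟨spread m.support, (spread_strictMono _).injective⟩ = m := by
  have hlen : (exponentWord m).length = m.support.card := by simp [exponentWord]
  have hval : ∀ i, (packedMonomial (exponentWord m)) i = m (spread m.support i) := by
    intro i
    rw [packedMonomial]
    by_cases hi : i < m.support.card
    · rw [List.toFinsupp_apply_lt _ _ (hlen ▸ hi), spread, dif_pos hi,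
        Finset.orderEmbOfFin_apply]
      simp [exponentWord]
    · rw [List.toFinsupp_apply_le _ _ (by omega), spread, dif_neg hi, eq_comm,
        ← Finsupp.notMem_support_iff]
      intro hmem
      have := Finset.le_sup (f := id) hmem
      simp only [id] at this
      omega
  ext j
  by_cases hj : ∃ i, spread m.support i = j
  · obtain ⟨i, rfl⟩ := hj
    rw [← hval i]
    exact Finsupp.embDomain_apply_self ⟨spread m.support, _⟩ _ i
  · rw [Finsupp.embDomain_of_notMem_range _ _ _ (by simpa using hj), eq_comm,
      ← Finsupp.notMem_support_iff]
    intro hmem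
    rw [← Finset.mem_coe, ← Finset.range_orderEmbOfFin m.support rfl] at hmem
    obtain ⟨i, hi⟩ := hmem
    exact hj ⟨i, by rw [spread, dif_pos i.2]; exact hi⟩

theorem exponentWord_packedMonomial (l : List ℕ) (hl : ∀ a ∈ l, 0 < a) :
    exponentWord (packedMonomial l) = l := by
  have hsupp : (packedMonomial l).support = Finset.range l.length := by
    ext i
    rw [Finsupp.mem_support_iff, Finset.mem_range, packedMonomial]
    by_cases hi : i < l.length
    · rw [List.toFinsupp_apply_lt _ _ hi]
      exact iff_of_true (hl _ (List.getElem_mem hi)).ne' hi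
    · rw [List.toFinsupp_apply_le _ _ (by omega)]
      simpa using hi
  rw [exponentWord, hsupp, Finset.sort_range]
  refine List.ext_getElem (by simp) fun i h1 h2 => ?_
  simp [packedMonomial, List.getElem?_eq_getElem h2]

/-- The algebra of quasisymmetric functions: power series of bounded degree in which any two
monomials `x_{i₁}^{a₁} ⋯ x_{i_k}^{a_k}` and `x_{j₁}^{a₁} ⋯ x_{j_k}^{a_k}` with `i₁ < ⋯ < i_k` and
`j₁ < ⋯ < j_k` have the same coefficient.  By `monomialBasis` below these are exactly the linear
combinations of the `M_α`. -/
def qsymSubalgebra : Subalgebra ℚ (MvPowerSeries ℕ ℚ) where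
  carrier := {f | (∃ d : ℕ, ∀ m, MvPowerSeries.coeff m f ≠ 0 → m.degree ≤ d) ∧
    ∀ m m', exponentWord m = exponentWord m' →
      MvPowerSeries.coeff m f = MvPowerSeries.coeff m' f}
  mul_mem' := by
    rintro f g ⟨⟨d, hd⟩, hf⟩ ⟨⟨d', hd'⟩, hg⟩
    refine ⟨⟨d + d', fun m hm => ?_⟩, ?_⟩
    · classical
      rw [MvPowerSeries.coeff_mul] at hm
      obtain ⟨p, hp, hne⟩ := Finset.exists_ne_zero_of_sum_ne_zero hm
      rw [Finset.HasAntidiagonal.mem_antidiagonal] at hp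
      rw [← hp, map_add]
      exact add_le_add (hd _ (left_ne_zero_of_mul hne)) (hd' _ (right_ne_zero_of_mul hne))
    · have key : ∀ (e : ℕ ↪ ℕ), StrictMono e → ∀ m : ℕ →₀ ℕ,
          MvPowerSeries.coeff (m.embDomain e) (f * g) = MvPowerSeries.coeff m (f * g) := by
        intro e he m
        classical
        rw [MvPowerSeries.coeff_mul, MvPowerSeries.coeff_mul,
          ← Finsupp.image_prodMap_embDomain_antidiagonal, Finset.sum_image]
        · refine Finset.sum_congr rfl fun p _ => ?_
          simp only [Prod.map_fst, Prod.map_snd]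
          rw [hf _ _ (exponentWord_embDomain e he p.1), hg _ _ (exponentWord_embDomain e he p.2)]
        · exact ((Finsupp.embDomain_injective e).prodMap
            (Finsupp.embDomain_injective e)).injOn
      intro m m' h
      rw [← embDomain_packedMonomial m, ← embDomain_packedMonomial m',
        key _ (spread_strictMono _), key _ (spread_strictMono _), h]
  add_mem' := by
    rintro f g ⟨⟨d, hd⟩, hf⟩ ⟨⟨d', hd'⟩, hg⟩
    refine ⟨⟨max d d', fun m hm => ?_⟩, fun m m' h => ?_⟩
    · by_contra hlt
      rw [not_le, max_lt_iff] at hlt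
      apply hm
      rw [map_add, not_not.1 (mt (hd m) (not_le.2 hlt.1)),
        not_not.1 (mt (hd' m) (not_le.2 hlt.2)), add_zero]
    · rw [map_add, map_add, hf _ _ h, hg _ _ h]
  algebraMap_mem' := by
    intro r
    have hw : ∀ m : ℕ →₀ ℕ, exponentWord m = [] ↔ m = 0 := by
      intro m
      simp [exponentWord, ← Finsupp.support_eq_empty, ← List.length_eq_zero_iff]
    classical
    refine ⟨⟨0, fun m hm => ?_⟩, fun m m' h => ?_⟩
    · rw [MvPowerSeries.algebraMap_apply, MvPowerSeries.coeff_C] at hm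
      have : m = 0 := by by_contra h; simp [h] at hm
      simp [this]
    · have : m = 0 ↔ m' = 0 := by rw [← hw, ← hw, h]
      rw [MvPowerSeries.algebraMap_apply, MvPowerSeries.coeff_C, MvPowerSeries.coeff_C]
      simp [this]

/-- The algebra `𝒬` of quasisymmetric functions over `ℚ`. -/
abbrev QSym : Type := ↥qsymSubalgebra

/-- The monomial quasisymmetric function `M_α` as an element of `𝒬`. -/
def monomialQSym {n : ℕ} (α : Composition n) : QSym :=
  ⟨monomialSeries α, by
    refine ⟨⟨n, fun m hm => ?_⟩, fun m m' h => ?_⟩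
    · have h : exponentWord m = α.blocks := by
        by_contra h
        exact hm (if_neg h)
      rw [← exponentWord_sum, h, α.blocks_sum]
    · change ite _ _ _ = ite _ _ _
      rw [h]⟩

theorem coeff_monomialQSym {n : ℕ} (α : Composition n) (m : ℕ →₀ ℕ) :
    MvPowerSeries.coeff m (monomialQSym α : MvPowerSeries ℕ ℚ) =
      if exponentWord m = α.blocks then 1 else 0 := rfl

/-- The fundamental quasisymmetric function `F_α`, the sum of the `M_β` over all compositions `β`
of `n` that refine `α`.  Refinement is containment of the sets of partial sums. -/
def fundamentalQSym {n : ℕ} (α : Composition n) : QSym :=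
  ∑ β : Composition n with α.boundaries ⊆ β.boundaries, monomialQSym β

theorem sigma_composition_ext {a b : Σ n : ℕ, Composition n} (h : a.2.blocks = b.2.blocks) :
    a = b := by
  obtain ⟨n, α⟩ := a
  obtain ⟨m, β⟩ := b
  have hnm : n = m := by rw [← α.blocks_sum, ← β.blocks_sum]; exact congrArg List.sum h
  subst hnm
  congr 1
  exact Composition.ext h

theorem monomialQSym_linearIndependent :
    LinearIndependent ℚ (fun a : Σ n : ℕ, Composition n => monomialQSym a.2) := by
  rw [linearIndependent_iff']
  intro s g hg a ha
  have h := congrArg (fun f : QSym => MvPowerSeries.coeff (packedMonomial a.2.blocks)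
    (f : MvPowerSeries ℕ ℚ)) hg
  simp only [AddSubmonoidClass.coe_finsetSum, SetLike.val_smul, map_sum, map_smul,
    coeff_monomialQSym, ZeroMemClass.coe_zero, map_zero, smul_eq_mul,
    exponentWord_packedMonomial _ (fun _ hx => a.2.blocks_pos hx)] at h
  rw [Finset.sum_eq_single a] at h
  · simpa using h
  · intro b _ hb
    rw [if_neg (fun hh => hb (sigma_composition_ext hh).symm), mul_zero]
  · exact fun h' => absurd ha h'

theorem monomialQSym_span :
    ⊤ ≤ Submodule.span ℚ (Set.range (fun a : Σ n : ℕ, Composition n => monomialQSym a.2)) := by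
  rintro ⟨f, ⟨d, hd⟩, hf⟩ -
  have : (⟨f, ⟨d, hd⟩, hf⟩ : QSym) =
      ∑ a ∈ (Finset.range (d + 1)).sigma (fun n => (Finset.univ : Finset (Composition n))),
        MvPowerSeries.coeff (packedMonomial a.2.blocks) f • monomialQSym a.2 := by
    apply Subtype.ext
    ext m
    simp only [AddSubmonoidClass.coe_finsetSum, SetLike.val_smul, map_sum, map_smul,
      coeff_monomialQSym, smul_eq_mul]
    have hm : MvPowerSeries.coeff (packedMonomial (exponentWord m)) f
        = MvPowerSeries.coeff m f :=
      hf _ _ (exponentWord_packedMonomial _ (exponentWord_pos m))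
    by_cases hdeg : m.degree ≤ d
    · let b : Σ n : ℕ, Composition n :=
        ⟨m.degree, ⟨exponentWord m, fun {i} hi => exponentWord_pos m i hi, exponentWord_sum m⟩⟩
      rw [Finset.sum_eq_single b]
      · simp [b, hm]
      · intro a _ hab
        rw [if_neg (fun hh => hab (sigma_composition_ext hh.symm)), mul_zero]
      · intro hb
        exact absurd (by simp [b]; omega) hb
    · rw [Finset.sum_eq_zero]
      · exact not_not.1 (mt (hd m) hdeg)
      · intro a ha
        rw [if_neg, mul_zero]
        intro hh
        simp only [Finset.mem_sigma, Finset.mem_range, Finset.mem_univ, and_true] at ha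
        have := exponentWord_sum m
        rw [hh, a.2.blocks_sum] at this
        omega
  rw [this]
  exact Submodule.sum_mem _ fun a _ => Submodule.smul_mem _ _ (Submodule.subset_span ⟨a, rfl⟩)

/-- The basis `{M_α}` of `𝒬`, indexed by all compositions of all `n ≥ 0`. -/
def monomialBasis : Module.Basis (Σ n : ℕ, Composition n) ℚ QSym :=
  .mk monomialQSym_linearIndependent monomialQSym_span

theorem composition_boundaries_injective (n : ℕ) :
    Function.Injective (fun α : Composition n => α.boundaries) := by
  intro α β h
  apply (compositionEquiv n).injective
  exact CompositionAsSet.ext h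

theorem length_lt_of_boundaries_ssubset {n : ℕ} {α β : Composition n}
    (h : α.boundaries ⊆ β.boundaries) (hne : α ≠ β) : α.length < β.length := by
  have := Finset.card_lt_card (h.ssubset_of_ne fun hh => hne (composition_boundaries_injective n hh))
  rw [α.card_boundaries_eq_succ_length, β.card_boundaries_eq_succ_length] at this
  omega

theorem coeff_fundamentalQSym {n : ℕ} (α β : Composition n) :
    MvPowerSeries.coeff (packedMonomial β.blocks) (fundamentalQSym α : MvPowerSeries ℕ ℚ) =
      if α.boundaries ⊆ β.boundaries then 1 else 0 := by
  simp only [fundamentalQSym, AddSubmonoidClass.coe_finsetSum, map_sum, coeff_monomialQSym,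
    exponentWord_packedMonomial _ (fun _ hx => β.blocks_pos hx), ← Composition.ext_iff]
  rw [Finset.sum_ite_eq]
  simp

theorem coeff_fundamentalQSym_of_ne {n n' : ℕ} (α : Composition n) (β : Composition n')
    (h : n ≠ n') :
    MvPowerSeries.coeff (packedMonomial β.blocks)
      (fundamentalQSym α : MvPowerSeries ℕ ℚ) = 0 := by
  simp only [fundamentalQSym, AddSubmonoidClass.coe_finsetSum, map_sum, coeff_monomialQSym,
    exponentWord_packedMonomial _ (fun _ hx => β.blocks_pos hx)]
  refine Finset.sum_eq_zero fun γ _ => if_neg fun hh => h ?_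
  rw [← γ.blocks_sum, ← β.blocks_sum, hh]

theorem fundamentalQSym_linearIndependent :
    LinearIndependent ℚ (fun a : Σ n : ℕ, Composition n => fundamentalQSym a.2) := by
  rw [linearIndependent_iff']
  intro s g hg
  by_contra! hcon
  obtain ⟨a0, ha0, hga0⟩ := hcon
  obtain ⟨a, ha, hmin⟩ := Finset.exists_min_image (s.filter fun a => g a ≠ 0)
    (fun a => a.2.length) ⟨a0, by simp [ha0, hga0]⟩
  simp only [Finset.mem_filter] at ha hmin
  have h := congrArg (fun f : QSym => MvPowerSeries.coeff (packedMonomial a.2.blocks)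
    (f : MvPowerSeries ℕ ℚ)) hg
  simp only [AddSubmonoidClass.coe_finsetSum, SetLike.val_smul, map_sum, map_smul,
    ZeroMemClass.coe_zero, map_zero, smul_eq_mul] at h
  rw [Finset.sum_eq_single a] at h
  · rw [coeff_fundamentalQSym] at h
    simp at h
    exact ha.2 h
  · rintro ⟨k, b⟩ hb hba
    obtain ⟨n, α⟩ := a
    by_cases hgb : g ⟨k, b⟩ = 0
    · rw [hgb, zero_mul]
    by_cases hk : k = n
    · subst hk
      rw [coeff_fundamentalQSym, if_neg, mul_zero]
      intro hsub
      have := length_lt_of_boundaries_ssubset hsub (fun hh => hba (congrArg _ hh))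
      exact absurd (hmin _ ⟨hb, hgb⟩) (not_le.2 this)
    · rw [coeff_fundamentalQSym_of_ne _ _ hk, mul_zero]
  · exact fun h' => absurd ha.1 h'

theorem monomialQSym_mem_span_fundamental {n : ℕ} (N : ℕ) :
    ∀ α : Composition n, n - α.length ≤ N → monomialQSym α ∈
      Submodule.span ℚ (Set.range fun a : Σ n : ℕ, Composition n => fundamentalQSym a.2) := by
  induction N with
  | zero => ?_
  | succ N ih => ?_
  all_goals
    intro α hα
    have hsplit : fundamentalQSym α = monomialQSym α +
        ∑ β ∈ (Finset.univ.filter fun β : Composition n =>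
          α.boundaries ⊆ β.boundaries).erase α, monomialQSym β := by
      rw [fundamentalQSym, Finset.add_sum_erase _ _ (by simp)]
    rw [eq_sub_of_add_eq hsplit.symm]
    refine Submodule.sub_mem _ (Submodule.subset_span ⟨⟨n, α⟩, rfl⟩)
      (Submodule.sum_mem _ fun β hβ => ?_)
    simp only [Finset.mem_erase, Finset.mem_filter, Finset.mem_univ, true_and] at hβ
    have h1 := length_lt_of_boundaries_ssubset hβ.2 (Ne.symm hβ.1)
    have h2 := β.length_le
  · omega
  · exact ih β (by omega)

/-- The fundamental basis `{F_α}` of `𝒬`. -/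
def fundamentalBasis : Module.Basis (Σ n : ℕ, Composition n) ℚ QSym :=
  .mk fundamentalQSym_linearIndependent <| by
    refine monomialQSym_span.trans (Submodule.span_le.2 ?_)
    rintro _ ⟨a, rfl⟩
    exact monomialQSym_mem_span_fundamental _ a.2 le_rfl

/-- The homogeneous component `𝒬_n`, the span of the `M_α` with `α` a composition of `n`. -/
def QSymDegree (n : ℕ) : Submodule ℚ QSym :=
  Submodule.span ℚ (Set.range fun α : Composition n => monomialQSym α)

/-! ### The coproduct and the universal character -/

/-- The composition formed by the first `i` parts. -/
def compositionTake {n : ℕ} (α : Composition n) (i : ℕ) : Composition (α.blocks.take i).sum :=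
  ⟨α.blocks.take i, fun h => α.blocks_pos (List.mem_of_mem_take h), rfl⟩

/-- The composition formed by all parts but the first `i`. -/
def compositionDrop {n : ℕ} (α : Composition n) (i : ℕ) : Composition (α.blocks.drop i).sum :=
  ⟨α.blocks.drop i, fun h => α.blocks_pos (List.mem_of_mem_drop h), rfl⟩

/-- The coproduct `Δ(M_α) = ∑_{α = β·γ} M_β ⊗ M_γ`, the sum over all ways to write `α` as a
concatenation of two possibly empty compositions, and the counit `ε(M_α) = δ_{α,()}`.  With this
structure `QSym →ₐc[ℚ] QSym` is the type of the linear maps that preserve product, unit, coproduct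
and counit, that is, of the bialgebra (equivalently, Hopf algebra) endomorphisms of `𝒬`. -/
instance QSym.instCoalgebraStruct : CoalgebraStruct ℚ QSym where
  comul := monomialBasis.constr ℚ fun a =>
    ∑ i ∈ Finset.range (a.2.length + 1),
      monomialQSym (compositionTake a.2 i) ⊗ₜ[ℚ] monomialQSym (compositionDrop a.2 i)
  counit := monomialBasis.constr ℚ fun a => if a.2.length = 0 then 1 else 0

/-- The universal character `X`, as a linear functional on `𝒬`: it takes the value `1` on `M_α`
if `α = ()` or `α = (n)`, and `0` otherwise. -/
def universalCharacter : QSym →ₗ[ℚ] ℚ :=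
  monomialBasis.constr ℚ fun a => if a.2.length ≤ 1 then 1 else 0

/-- The product `V ⋆ W` on the dual space of `𝒬` that is dual to the coproduct:
`(V ⋆ W)(M_α) = ∑_{α = β·γ} V(M_β) W(M_γ)`. -/
def convolution (V W : QSym →ₗ[ℚ] ℚ) : QSym →ₗ[ℚ] ℚ :=
  LinearMap.mul' ℚ ℚ ∘ₗ TensorProduct.map V W ∘ₗ CoalgebraStruct.comul

/-- `Φ` is a degree-preserving Hopf algebra endomorphism of `𝒬` with `X^Φ = X ⋆ X`, where
`X^Φ = X ∘ Φ`. -/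
def IsPsiTwo (Φ : QSym →ₐc[ℚ] QSym) : Prop :=
  (∀ n : ℕ, ∀ f ∈ QSymDegree n, Φ f ∈ QSymDegree n) ∧
  ∀ f : QSym, universalCharacter (Φ f) = convolution universalCharacter universalCharacter f

/-! ### Graded posets and the Tchebyshev operator of the second kind

A graded poset with `0̂` and `1̂` is a finite bounded partial order with a rank function, given by
`GradeMinOrder ℕ`: it is strictly monotone, increases by one along covers, and vanishes at `0̂`. -/

section Posets

variable {P : Type} [PartialOrder P] [GradeMinOrder ℕ P]

/-- The composition `(ρ(t₀,t₁), …, ρ(t_{k-1},t_k))` of rank differences of a chain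
`t₀ < t₁ < ⋯ < t_k`. -/
def chainType (c : LTSeries P) :
    Composition (List.ofFn fun i : Fin c.length =>
      grade ℕ (c i.succ) - grade ℕ (c i.castSucc)).sum where
  blocks := List.ofFn fun i : Fin c.length => grade ℕ (c i.succ) - grade ℕ (c i.castSucc)
  blocks_pos := by
    intro i hi
    rw [List.mem_ofFn] at hi
    obtain ⟨j, rfl⟩ := hi
    exact Nat.sub_pos_of_lt (grade_strictMono (c.step j))
  blocks_sum := rfl

open Classical in
/-- The set of all chains `s = t₀ < t₁ < ⋯ < t_k = t`, with `k ≥ 0` arbitrary. -/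
def chainsBetween [Fintype P] (s t : P) : Finset (LTSeries P) :=
  Finset.univ.filter fun c => c.head = s ∧ c.last = t

/-- The quasisymmetric function `F([s,t])` of the interval `[s,t]`, the sum of
`M_{(ρ(t₀,t₁), …, ρ(t_{k-1},t_k))}` over the chains `s = t₀ < t₁ < ⋯ < t_k = t`. -/
def intervalQSym [Fintype P] (s t : P) : QSym :=
  ∑ c ∈ chainsBetween s t, monomialQSym (chainType c)

end Posets

/-- The quasisymmetric function `F(P)` of a graded poset `P`. -/
def posetQSym (P : Type) [PartialOrder P] [BoundedOrder P] [Fintype P] [GradeMinOrder ℕ P] :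
    QSym :=
  intervalQSym (⊥ : P) ⊤

/-- `G` is a functional with `G(F(P)) = #P` for every graded poset `P`. -/
def CountsElements (G : QSym →ₗ[ℚ] ℚ) : Prop :=
  ∀ (P : Type) [PartialOrder P] [BoundedOrder P] [Fintype P] [GradeMinOrder ℕ P],
    G (posetQSym P) = (Fintype.card P : ℚ)

/-- The defining property of the Tchebyshev operator of the second kind: for every graded poset
`P`, the operator `U` sends `F(P)` to the sum over all chains `0̂ = t₀ < t₁ < ⋯ < t_k = 1̂` of
`G(F([t₀,t₁])) ⋯ G(F([t_{k-1},t_k])) · M_{(ρ(t₀,t₁), …, ρ(t_{k-1},t_k))}`. -/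
def IsTchebyshevU (G : QSym →ₗ[ℚ] ℚ) (U : QSym →ₗ[ℚ] QSym) : Prop :=
  ∀ (P : Type) [PartialOrder P] [BoundedOrder P] [Fintype P] [GradeMinOrder ℕ P],
    U (posetQSym P) = ∑ c ∈ chainsBetween (⊥ : P) ⊤,
      (∏ i : Fin c.length, G (intervalQSym (c i.castSucc) (c i.succ))) •
        monomialQSym (chainType c)

/-! ### Riffle shuffles and descents -/

/-- The binomial distribution of the size of the top packet when a deck of `n` cards is cut. -/
def binomialCut (n : ℕ) : PMF (Fin (n + 1)) :=
  PMF.ofFintype (fun c => (n.choose c : ENNReal) / 2 ^ n) <| by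
    simp only [div_eq_mul_inv]
    rw [← Finset.sum_mul, ← Nat.cast_sum, Fin.sum_univ_eq_sum_range (fun c => n.choose c) (n + 1),
      Nat.sum_range_choose]
    push_cast
    exact ENNReal.mul_inv_cancel (by simp) (by finiteness)

/-- The coin that shows `true` with probability `a / (a + b)`, for packets of positive sizes
`a` and `b`. -/
def packetCoin (a b : ℕ) (h : 0 < a) : PMF Bool :=
  PMF.ofFintype (fun t => ((if t then a else b : ℕ) : ENNReal) / ((a + b : ℕ) : ENNReal)) <| by
    simp only [Fintype.sum_bool, if_true, Bool.false_eq_true, if_false]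
    rw [ENNReal.div_add_div_same, ← Nat.cast_add]
    exact ENNReal.div_self (by simp; omega) (by finiteness)

/-- Cards fall one at a time from the bottoms of two packets onto a new pile; the next card falls
from a given packet with probability proportional to the current size of that packet.  Packets
and pile are listed from bottom to top. -/
def dropCards {C : Type} : List C → List C → PMF (List C)
  | [], B => PMF.pure B
  | A, [] => PMF.pure A
  | a :: A, b :: B =>
      (packetCoin (A.length + 1) (B.length + 1) A.length.succ_pos).bind fun t =>
        if t then (dropCards A (b :: B)).map (a :: ·) else (dropCards (a :: A) B).map (b :: ·)
  termination_by A B => A.length + B.length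

/-- One Gilbert–Shannon–Reeds riffle shuffle of a deck, listed from top to bottom. -/
def riffle {C : Type} (deck : List C) : PMF (List C) :=
  (binomialCut deck.length).bind fun c =>
    (dropCards (deck.take c).reverse (deck.drop c).reverse).map List.reverse

/-- The distribution of the deck after `k` independent successive riffle shuffles. -/
def riffles {C : Type} : ℕ → List C → PMF (List C)
  | 0, deck => PMF.pure deck
  | k + 1, deck => (riffles k deck).bind riffle

/-- The descent set of a permutation: `i` (counted from `0`) belongs to it if and only if the
entries at the positions `i` and `i + 1` satisfy `σ_i > σ_{i+1}`. -/
def descentSet {n : ℕ} (σ : Equiv.Perm (Fin n)) : Finset (Fin (n - 1)) :=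
  Finset.univ.filter fun i =>
    σ ⟨(i : ℕ), by omega⟩ > σ ⟨(i : ℕ) + 1, by omega⟩

/-- The descent composition `D(σ)`, the composition of `n` whose set of proper partial sums is the
descent set of `σ`. -/
def descentComposition {n : ℕ} (σ : Equiv.Perm (Fin n)) : Composition n :=
  ((compositionAsSetEquiv n).symm (descentSet σ)).toComposition

/-- The probability that `k` riffle shuffles of a deck of `n` cards, started in increasing order,
end in a permutation with descent composition `α`.  The arrangement `σ` has the card `σ i` in
position `i`. -/
def riffleDescentProb (n k : ℕ) (α : Composition n) : ENNReal :=
  ∑ σ : Equiv.Perm (Fin n) with descentComposition σ = α,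
    riffles k (List.finRange n) (List.ofFn σ)

/-- The composition `(n)` of `n` with one part; it is the empty composition if `n = 0`. -/
def rowComposition : (n : ℕ) → Composition n
  | 0 => Composition.ones 0
  | n + 1 => Composition.single (n + 1) n.succ_pos

end

/-! Why the theorem holds.  Write `[x^l] f` for the coefficient of `x_0^{a₁} ⋯ x_{k-1}^{a_k}` in
`f`, where `l = [a₁, …, a_k]` may contain zeros (`coeffAt l f`).  Everything is read off from these
functionals: the product of `𝒬` sums over the entrywise splittings of `l` (`coeffAt_mul`), and the
coproduct is dual to concatenation of lists (`convolution_coeffAt`).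

*The endomorphism `Ψ₂`* is the substitution `f(x₀, x₁, …) ↦ f(x₀, x₀, x₁, x₁, …)`, visibly an
algebra map.  Its coefficient at `l` is the sum of the coefficients of `f` at the interleavings of
the splittings of `l` (`coeffAt_psi`); interleaving respects concatenation, so it is a coalgebra
map, and `X ∘ Ψ₂ = X ⋆ X` is the case of a list with one entry.  Uniqueness: the functional
`[x^(a :: l)]` is the convolution of `[x^[a]]`, which is `X` restricted to degree `a`, with `[x^l]`.

*The functional `G`* is `X ∘ Ψ₂`.  The coproduct of `F([s,t])` is `∑ F([s,u]) ⊗ F([u,t])` and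
`X (F([s,t])) = 1`, so `(X ⋆ X)(F(P))` counts the elements of `P`.

*The operator `U`* is `Ψ₂`: the first step of a chain gives a recursion for the coefficients of
chain sums, and `Ψ₂ (F([s,t]))` satisfies the recursion of the sum weighted by `G`
(`psi_intervalQSym`).  The uniqueness of `G` and of `U` holds because the `F(P)` span `𝒬`:
`M_β` is an alternating sum over posets whose levels have one or two elements
(`monomialQSym_eq_sum_levelQSym`).

*Riffle shuffles.*  For a word `w` with distinct letters let `F_w` be the fundamental function of
its descent composition (`wordQSym`).  Then `Δ F_w` is the sum of `F_u ⊗ F_v` over the ways to cut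
`w` into `u v`, and `F_u F_v` is the sum of the `F_w` over the shuffles `w` of `u` and `v`.  Since
dropping cards makes all shuffles of the two packets equally likely, one riffle shuffle acts on the
functions `F_w` as `2⁻ⁿ A`, where `A = id ⋆ id` is the coproduct followed by the product
(`squareOperator_wordQSym_ofFn`).  The operator `A` is not `Ψ₂`, but the two agree on `F_{(n)}`
(`psi_wordQSym_of_sorted`), and they commute because `Ψ₂` is a bialgebra map.  Hence
`Ψ₂^k F_{(n)} = A^k F_{(n)}`, which is `2^{nk}` times the expected value of `F_w` for the deck `w`
after `k` shuffles. -/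

noncomputable section

open scoped TensorProduct

/-! ### Coefficients of quasisymmetric functions -/

theorem exponentWord_eq_filter_range (m : ℕ →₀ ℕ) (N : ℕ) (hN : ∀ i, N ≤ i → m i = 0) :
    exponentWord m = ((List.range N).map m).filter (0 < ·) := by
  have hs : m.support.sort = (List.range N).filter fun i => 0 < m i := by
    refine List.Perm.eq_of_pairwise' (r := (· ≤ ·)) (Finset.pairwise_sort _ _) ?_ ?_
    · exact (List.pairwise_le_range).filter _
    · rw [List.perm_ext_iff_of_nodup (Finset.sort_nodup _ _) (List.nodup_range.filter _)]
      intro i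
      simp only [Finset.mem_sort, Finsupp.mem_support_iff, List.mem_filter, List.mem_range,
        decide_eq_true_eq]
      constructor
      · intro h
        exact ⟨by by_contra h'; exact h (hN i (by omega)), by omega⟩
      · rintro ⟨_, h⟩
        omega
  rw [exponentWord, hs, List.filter_map]
  rfl

theorem exponentWord_packedMonomial_filter (l : List ℕ) :
    exponentWord (packedMonomial l) = l.filter (0 < ·) := by
  rw [exponentWord_eq_filter_range _ l.length]
  · congr 1
    refine List.ext_getElem (by simp) fun i h1 h2 => ?_
    simp [packedMonomial, List.getElem?_eq_getElem h2]
  · intro i hi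
    exact List.toFinsupp_apply_le _ _ hi

/-- The coefficient of `x_0^{a₁} ⋯ x_{k-1}^{a_k}` in a quasisymmetric function, as a linear
functional.  Parts equal to `0` are allowed in the list `[a₁, …, a_k]`. -/
def coeffAt (l : List ℕ) : QSym →ₗ[ℚ] ℚ :=
  (MvPowerSeries.coeff (packedMonomial l)) ∘ₗ qsymSubalgebra.val.toLinearMap

theorem coeffAt_apply (l : List ℕ) (f : QSym) :
    coeffAt l f = MvPowerSeries.coeff (packedMonomial l) (f : MvPowerSeries ℕ ℚ) := rfl

theorem coeff_eq_coeffAt (m : ℕ →₀ ℕ) (f : QSym) :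
    MvPowerSeries.coeff m (f : MvPowerSeries ℕ ℚ) = coeffAt (exponentWord m) f :=
  f.2.2 _ _ (exponentWord_packedMonomial _ (exponentWord_pos m)).symm

theorem coeffAt_filter (l : List ℕ) (f : QSym) :
    coeffAt (l.filter (0 < ·)) f = coeffAt l f := by
  rw [coeffAt_apply l, coeff_eq_coeffAt, exponentWord_packedMonomial_filter]

theorem coeffAt_congr {l l' : List ℕ} (h : l.filter (0 < ·) = l'.filter (0 < ·)) (f : QSym) :
    coeffAt l f = coeffAt l' f := by
  rw [← coeffAt_filter l, h, coeffAt_filter]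

theorem coeffAt_monomialQSym {n : ℕ} (α : Composition n) (l : List ℕ) :
    coeffAt l (monomialQSym α) = if l.filter (0 < ·) = α.blocks then 1 else 0 := by
  rw [coeffAt_apply, coeff_monomialQSym, exponentWord_packedMonomial_filter]

theorem filter_eq_self_of_pos {l : List ℕ} (hl : ∀ a ∈ l, 0 < a) : l.filter (0 < ·) = l :=
  List.filter_eq_self.2 fun a ha => by simpa using hl a ha

theorem qsym_ext {f g : QSym} (h : ∀ l : List ℕ, (∀ a ∈ l, 0 < a) → coeffAt l f = coeffAt l g) :
    f = g := by
  apply Subtype.ext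
  ext m
  rw [coeff_eq_coeffAt, coeff_eq_coeffAt, h _ (exponentWord_pos m)]

@[simp] theorem monomialBasis_apply (a : Σ n : ℕ, Composition n) :
    monomialBasis a = monomialQSym a.2 := by
  simp [monomialBasis]

theorem linearMap_ext_monomial {V : Type*} [AddCommMonoid V] [Module ℚ V] {φ ψ : QSym →ₗ[ℚ] V}
    (h : ∀ (n : ℕ) (α : Composition n), φ (monomialQSym α) = ψ (monomialQSym α)) : φ = ψ :=
  monomialBasis.ext fun a => by simpa using h a.1 a.2

/-- The composition whose list of parts is `l`. -/
def compositionOfList (l : List ℕ) (hl : ∀ a ∈ l, 0 < a) : Composition l.sum :=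
  ⟨l, fun h => hl _ h, rfl⟩

theorem monomialBasis_coord (a : Σ n : ℕ, Composition n) :
    monomialBasis.coord a = coeffAt a.2.blocks := by
  refine linearMap_ext_monomial fun n α => ?_
  have h : monomialQSym α = monomialBasis ⟨n, α⟩ := by simp
  rw [coeffAt_monomialQSym, filter_eq_self_of_pos fun _ hx => a.2.blocks_pos hx, h,
    Module.Basis.coord_apply, Module.Basis.repr_self, Finsupp.single_apply]
  refine if_congr ⟨fun h => by rw [← h], fun h => sigma_composition_ext h.symm⟩ rfl rfl

theorem comul_monomialQSym {n : ℕ} (α : Composition n) :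
    CoalgebraStruct.comul (R := ℚ) (monomialQSym α) =
      ∑ i ∈ Finset.range (α.length + 1),
        monomialQSym (compositionTake α i) ⊗ₜ[ℚ] monomialQSym (compositionDrop α i) := by
  have h : monomialQSym α = monomialBasis ⟨n, α⟩ := by simp
  rw [h]
  exact monomialBasis.constr_basis ℚ _ _

theorem counit_eq_coeffAt : CoalgebraStruct.counit (R := ℚ) (A := QSym) = coeffAt [] := by
  refine linearMap_ext_monomial fun n α => ?_
  have h : monomialQSym α = monomialBasis ⟨n, α⟩ := by simp
  rw [coeffAt_monomialQSym, h]
  refine (monomialBasis.constr_basis ℚ _ _).trans (if_congr ?_ rfl rfl)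
  simp [Composition.length, eq_comm]

theorem convolution_monomialQSym (V W : QSym →ₗ[ℚ] ℚ) {n : ℕ} (α : Composition n) :
    convolution V W (monomialQSym α) = ∑ i ∈ Finset.range (α.length + 1),
      V (monomialQSym (compositionTake α i)) * W (monomialQSym (compositionDrop α i)) := by
  simp [convolution, comul_monomialQSym]

/-- The coproduct is dual to concatenation of lists of exponents. -/
theorem convolution_coeffAt (l l' : List ℕ) :
    convolution (coeffAt l) (coeffAt l') = coeffAt (l ++ l') := by
  refine linearMap_ext_monomial fun n α => ?_
  rw [convolution_monomialQSym]
  simp only [coeffAt_monomialQSym, compositionTake, compositionDrop, List.filter_append]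
  generalize l.filter (0 < ·) = a
  generalize l'.filter (0 < ·) = b
  simp only [← ite_and, mul_ite, mul_one, mul_zero]
  by_cases h : a ++ b = α.blocks
  · rw [if_pos h, Finset.sum_eq_single a.length]
    · simp [← h]
    · intro i hi hne
      rw [if_neg]
      rintro ⟨-, h2⟩
      apply hne
      have := congrArg List.length h2
      rw [Finset.mem_range, Composition.length] at hi
      rw [List.length_take] at this
      omega
    · intro hi
      exact absurd (by rw [Finset.mem_range, Composition.length, ← h]; simp) hi
  · rw [if_neg h]
    refine Finset.sum_eq_zero fun i _ => if_neg ?_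
    rintro ⟨h1, h2⟩
    exact h (by rw [h1, h2, List.take_append_drop])

theorem tensor_ext {z z' : QSym ⊗[ℚ] QSym}
    (h : ∀ l l' : List ℕ, (∀ a ∈ l, 0 < a) → (∀ a ∈ l', 0 < a) →
      LinearMap.mul' ℚ ℚ (TensorProduct.map (coeffAt l) (coeffAt l') z) =
        LinearMap.mul' ℚ ℚ (TensorProduct.map (coeffAt l) (coeffAt l') z')) : z = z' := by
  have key : ∀ a b, (monomialBasis.tensorProduct monomialBasis).coord (a, b) =
      LinearMap.mul' ℚ ℚ ∘ₗ TensorProduct.map (coeffAt a.2.blocks) (coeffAt b.2.blocks) := by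
    intro a b
    refine TensorProduct.ext' fun f g => ?_
    simp [← monomialBasis_coord, mul_comm]
  refine (monomialBasis.tensorProduct monomialBasis).ext_elem fun ab => ?_
  have := h ab.1.2.blocks ab.2.2.blocks (fun _ hx => ab.1.2.blocks_pos hx)
    (fun _ hx => ab.2.2.blocks_pos hx)
  rw [← Module.Basis.coord_apply, ← Module.Basis.coord_apply, key]
  exact this

/-- The pairs of lists of natural numbers of the same length as `l` whose entrywise sum is `l`. -/
def listAntidiagonal : List ℕ → Finset (List ℕ × List ℕ)
  | [] => {([], [])}
  | a :: l => (Finset.HasAntidiagonal.antidiagonal a ×ˢ listAntidiagonal l).map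
      ⟨fun x => (x.1.1 :: x.2.1, x.1.2 :: x.2.2), by
        rintro ⟨⟨_, _⟩, _, _⟩ ⟨⟨_, _⟩, _, _⟩ h
        simp_all⟩

theorem sum_listAntidiagonal_nil {V : Type*} [AddCommMonoid V] (φ : List ℕ × List ℕ → V) :
    ∑ x ∈ listAntidiagonal [], φ x = φ ([], []) := by
  simp [listAntidiagonal]

theorem sum_listAntidiagonal_cons {V : Type*} [AddCommMonoid V] (φ : List ℕ × List ℕ → V)
    (a : ℕ) (l : List ℕ) :
    ∑ x ∈ listAntidiagonal (a :: l), φ x =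
      ∑ p ∈ Finset.HasAntidiagonal.antidiagonal a, ∑ x ∈ listAntidiagonal l, φ (p.1 :: x.1, p.2 :: x.2) := by
  rw [listAntidiagonal, Finset.sum_map, Finset.sum_product]
  rfl

theorem mem_listAntidiagonal_nil (x : List ℕ × List ℕ) :
    x ∈ listAntidiagonal [] ↔ x = ([], []) := by
  simp [listAntidiagonal]

theorem mem_listAntidiagonal_cons (x : List ℕ × List ℕ) (a : ℕ) (l : List ℕ) :
    x ∈ listAntidiagonal (a :: l) ↔ ∃ i j p q, i + j = a ∧ (p, q) ∈ listAntidiagonal l ∧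
      x = (i :: p, j :: q) := by
  simp only [listAntidiagonal, Finset.mem_map, Finset.mem_product, Finset.HasAntidiagonal.mem_antidiagonal,
    Prod.exists]
  constructor
  · rintro ⟨i, j, p, q, ⟨h1, h2⟩, rfl⟩
    exact ⟨i, j, p, q, h1, h2, rfl⟩
  · rintro ⟨i, j, p, q, h1, h2, rfl⟩
    exact ⟨i, j, p, q, ⟨h1, h2⟩, rfl⟩

theorem length_of_mem_listAntidiagonal {l : List ℕ} {x : List ℕ × List ℕ}
    (h : x ∈ listAntidiagonal l) : x.1.length = l.length ∧ x.2.length = l.length := by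
  induction l generalizing x with
  | nil => rw [mem_listAntidiagonal_nil] at h; simp [h]
  | cons a l ih =>
    rw [mem_listAntidiagonal_cons] at h
    obtain ⟨i, j, p, q, -, h, rfl⟩ := h
    simpa using ih h

theorem sum_of_mem_listAntidiagonal {l : List ℕ} {x : List ℕ × List ℕ}
    (h : x ∈ listAntidiagonal l) : x.1.sum + x.2.sum = l.sum := by
  induction l generalizing x with
  | nil => rw [mem_listAntidiagonal_nil] at h; simp [h]
  | cons a l ih =>
    rw [mem_listAntidiagonal_cons] at h
    obtain ⟨i, j, p, q, hij, h, rfl⟩ := h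
    have := ih h
    simp only [List.sum_cons] at this ⊢
    omega

theorem packedMonomial_nil : packedMonomial [] = 0 := by
  ext i; simp [packedMonomial]

theorem packedMonomial_cons_zero (a : ℕ) (l : List ℕ) : packedMonomial (a :: l) 0 = a := by
  simp [packedMonomial]

theorem packedMonomial_cons_succ (a : ℕ) (l : List ℕ) (i : ℕ) :
    packedMonomial (a :: l) (i + 1) = packedMonomial l i := by
  simp [packedMonomial]

theorem packedMonomial_injective {l l' : List ℕ} (hl : l.length = l'.length)
    (h : packedMonomial l = packedMonomial l') : l = l' := by
  induction l generalizing l' with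
  | nil => exact (List.length_eq_zero_iff.1 hl.symm).symm
  | cons a l ih =>
    cases l' with
    | nil => simp at hl
    | cons b l' =>
      have h0 := DFunLike.congr_fun h 0
      rw [packedMonomial_cons_zero, packedMonomial_cons_zero] at h0
      rw [h0, ih (by simpa using hl)]
      ext i
      simpa [packedMonomial_cons_succ] using DFunLike.congr_fun h (i + 1)

theorem exists_listAntidiagonal (l : List ℕ) (u v : ℕ →₀ ℕ) (h : u + v = packedMonomial l) :
    ∃ x ∈ listAntidiagonal l, packedMonomial x.1 = u ∧ packedMonomial x.2 = v := by
  induction l generalizing u v with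
  | nil =>
    refine ⟨([], []), by simp [mem_listAntidiagonal_nil], ?_⟩
    rw [packedMonomial_nil] at h ⊢
    obtain ⟨h1, h2⟩ := add_eq_zero.1 h
    exact ⟨h1.symm, h2.symm⟩
  | cons a l ih =>
    obtain ⟨x, hx, hx1, hx2⟩ := ih (u.comapDomain Nat.succ (Nat.succ_injective.injOn))
      (v.comapDomain Nat.succ (Nat.succ_injective.injOn)) (by
        ext i
        simpa [packedMonomial_cons_succ] using DFunLike.congr_fun h (i + 1))
    refine ⟨(u 0 :: x.1, v 0 :: x.2), (mem_listAntidiagonal_cons _ _ _).2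
      ⟨u 0, v 0, x.1, x.2, ?_, hx, rfl⟩, ?_, ?_⟩
    · simpa [packedMonomial_cons_zero] using DFunLike.congr_fun h 0
    · ext i
      cases i with
      | zero => exact packedMonomial_cons_zero _ _
      | succ i => simp [packedMonomial_cons_succ, hx1]
    · ext i
      cases i with
      | zero => exact packedMonomial_cons_zero _ _
      | succ i => simp [packedMonomial_cons_succ, hx2]

theorem add_packedMonomial_of_mem {l : List ℕ} {x : List ℕ × List ℕ}
    (h : x ∈ listAntidiagonal l) : packedMonomial x.1 + packedMonomial x.2 = packedMonomial l := by
  induction l generalizing x with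
  | nil => rw [mem_listAntidiagonal_nil] at h; simp [h, packedMonomial_nil]
  | cons a l ih =>
    rw [mem_listAntidiagonal_cons] at h
    obtain ⟨i, j, p, q, hij, h, rfl⟩ := h
    ext k
    cases k with
    | zero => simpa [packedMonomial_cons_zero] using hij
    | succ k => simpa [packedMonomial_cons_succ] using DFunLike.congr_fun (ih h) k

theorem sum_antidiagonal_packedMonomial {V : Type*} [AddCommMonoid V] (l : List ℕ)
    (φ : (ℕ →₀ ℕ) × (ℕ →₀ ℕ) → V) :
    ∑ x ∈ Finset.HasAntidiagonal.antidiagonal (packedMonomial l), φ x =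
      ∑ x ∈ listAntidiagonal l, φ (packedMonomial x.1, packedMonomial x.2) := by
  symm
  refine Finset.sum_bij (fun x _ => (packedMonomial x.1, packedMonomial x.2)) ?_ ?_ ?_ ?_
  · intro x hx
    simpa using add_packedMonomial_of_mem hx
  · intro x hx y hy h
    have hx := length_of_mem_listAntidiagonal hx
    have hy := length_of_mem_listAntidiagonal hy
    rw [Prod.mk.injEq] at h
    exact Prod.ext (packedMonomial_injective (hx.1.trans hy.1.symm) h.1)
      (packedMonomial_injective (hx.2.trans hy.2.symm) h.2)
  · rintro ⟨u, v⟩ h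
    obtain ⟨x, hx, h1, h2⟩ := exists_listAntidiagonal l u v (by simpa using h)
    exact ⟨x, hx, Prod.ext h1 h2⟩
  · intros; rfl

theorem coeffAt_mul (l : List ℕ) (f g : QSym) :
    coeffAt l (f * g) = ∑ x ∈ listAntidiagonal l, coeffAt x.1 f * coeffAt x.2 g := by
  classical
  rw [coeffAt_apply, MulMemClass.coe_mul, MvPowerSeries.coeff_mul, sum_antidiagonal_packedMonomial]
  rfl

/-! ### The endomorphism `Ψ₂` -/

/-- The fold `2 i, 2 i + 1 ↦ i` of the set of variables has finite fibres. -/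
instance tendstoCofinite_half : Filter.TendstoCofinite (fun i : ℕ => i / 2) :=
  (Filter.tendstoCofinite_iff_finite_preimage_singleton _).2 fun b =>
    (Set.finite_Iio (2 * b + 2)).subset fun i hi => by
      simp only [Set.mem_preimage, Set.mem_singleton_iff] at hi
      simp only [Set.mem_Iio]
      omega

/-- The exponent vector with the entries of `u` at the even and those of `v` at the odd places. -/
def mergeExponents (u v : ℕ →₀ ℕ) : ℕ →₀ ℕ :=
  u.mapDomain (fun i => 2 * i) + v.mapDomain (fun i => 2 * i + 1)

theorem injective_two_mul : Function.Injective fun i : ℕ => 2 * i := fun i j h => by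
  dsimp only at h; omega

theorem injective_two_mul_add_one : Function.Injective fun i : ℕ => 2 * i + 1 := fun i j h => by
  dsimp only at h; omega

theorem mergeExponents_even (u v : ℕ →₀ ℕ) (i : ℕ) : mergeExponents u v (2 * i) = u i := by
  rw [mergeExponents, Finsupp.add_apply, Finsupp.mapDomain_apply injective_two_mul u i,
    Finsupp.mapDomain_of_notMem_range, add_zero]
  rintro ⟨j, hj⟩
  dsimp only at hj; omega

theorem mergeExponents_odd (u v : ℕ →₀ ℕ) (i : ℕ) : mergeExponents u v (2 * i + 1) = v i := by
  rw [mergeExponents, Finsupp.add_apply, Finsupp.mapDomain_apply injective_two_mul_add_one v i,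
    Finsupp.mapDomain_of_notMem_range, zero_add]
  rintro ⟨j, hj⟩
  dsimp only at hj; omega

theorem eq_mergeExponents {m u v : ℕ →₀ ℕ} (h0 : ∀ i, m (2 * i) = u i)
    (h1 : ∀ i, m (2 * i + 1) = v i) : m = mergeExponents u v := by
  ext k
  obtain ⟨i, rfl | rfl⟩ : ∃ i, k = 2 * i ∨ k = 2 * i + 1 := ⟨k / 2, by omega⟩
  · rw [mergeExponents_even, h0]
  · rw [mergeExponents_odd, h1]

theorem mapDomain_half_mergeExponents (u v : ℕ →₀ ℕ) :
    (mergeExponents u v).mapDomain (fun i => i / 2) = u + v := by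
  have h0 : (fun i : ℕ => i / 2) ∘ (fun i => 2 * i) = id := by
    funext i
    simp
  have h1 : (fun i : ℕ => i / 2) ∘ (fun i => 2 * i + 1) = id := by
    funext i
    simp only [Function.comp_apply, id_eq]
    omega
  rw [mergeExponents, Finsupp.mapDomain_add, ← Finsupp.mapDomain_comp, ← Finsupp.mapDomain_comp,
    h0, h1, Finsupp.mapDomain_id, Finsupp.mapDomain_id]

theorem degree_mergeExponents (u v : ℕ →₀ ℕ) :
    (mergeExponents u v).degree = (u + v).degree := by
  rw [← mapDomain_half_mergeExponents, Finsupp.degree_mapDomain]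

theorem mergeExponents_mapDomain (e : ℕ → ℕ) (u v : ℕ →₀ ℕ) :
    mergeExponents (u.mapDomain e) (v.mapDomain e) =
      (mergeExponents u v).mapDomain fun k => 2 * e (k / 2) + k % 2 := by
  simp only [mergeExponents, Finsupp.mapDomain_add, ← Finsupp.mapDomain_comp]
  congr 2
  · ext i; simp
  · ext i
    simp only [Function.comp_apply]
    have h1 : (2 * i + 1) / 2 = i := by omega
    rw [h1]
    omega

/-- The coefficients of `f(x₀, x₀, x₁, x₁, …)`. -/
theorem coeff_rename_half (f : MvPowerSeries ℕ ℚ) (m : ℕ →₀ ℕ) :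
    MvPowerSeries.coeff m (MvPowerSeries.rename (fun i : ℕ => i / 2) f) =
      ∑ x ∈ Finset.HasAntidiagonal.antidiagonal m,
        MvPowerSeries.coeff (mergeExponents x.1 x.2) f := by
  rw [MvPowerSeries.coeff_rename]
  symm
  refine Finset.sum_bij (fun x _ => mergeExponents x.1 x.2) ?_ ?_ ?_ ?_
  · intro x hx
    rw [Finset.HasAntidiagonal.mem_antidiagonal] at hx
    simpa [mapDomain_half_mergeExponents] using hx
  · intro x _ y _ h
    refine Prod.ext ?_ ?_
    · ext i
      rw [← mergeExponents_even x.1 x.2, h, mergeExponents_even]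
    · ext i
      rw [← mergeExponents_odd x.1 x.2, h, mergeExponents_odd]
  · intro x hx
    have hx' := eq_mergeExponents (m := x)
      (u := x.comapDomain (fun i => 2 * i) injective_two_mul.injOn)
      (v := x.comapDomain (fun i => 2 * i + 1) injective_two_mul_add_one.injOn)
      (fun i => by simp) (fun i => by simp)
    refine ⟨(x.comapDomain (fun i => 2 * i) injective_two_mul.injOn,
      x.comapDomain (fun i => 2 * i + 1) injective_two_mul_add_one.injOn), ?_, hx'.symm⟩
    rw [Finset.HasAntidiagonal.mem_antidiagonal, ← mapDomain_half_mergeExponents, ← hx']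
    simpa using hx
  · intros; rfl

theorem rename_half_mem (f : QSym) :
    MvPowerSeries.rename (fun i : ℕ => i / 2) (f : MvPowerSeries ℕ ℚ) ∈ qsymSubalgebra := by
  obtain ⟨f, ⟨d, hd⟩, hf⟩ := f
  refine ⟨⟨d, fun m hm => ?_⟩, ?_⟩
  · rw [coeff_rename_half] at hm
    obtain ⟨x, hx, hne⟩ := Finset.exists_ne_zero_of_sum_ne_zero hm
    rw [Finset.HasAntidiagonal.mem_antidiagonal] at hx
    rw [← hx, ← degree_mergeExponents]
    exact hd _ hne
  · have key : ∀ (e : ℕ ↪ ℕ), StrictMono e → ∀ m : ℕ →₀ ℕ,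
        MvPowerSeries.coeff (m.embDomain e) (MvPowerSeries.rename (fun i : ℕ => i / 2) f) =
          MvPowerSeries.coeff m (MvPowerSeries.rename (fun i : ℕ => i / 2) f) := by
      intro e he m
      have he2 : StrictMono fun k => 2 * e (k / 2) + k % 2 := by
        intro i j hij
        dsimp only
        rcases Nat.lt_or_ge (i / 2) (j / 2) with h | h
        · have := he h
          omega
        · have h' : i / 2 = j / 2 := by omega
          rw [h']
          omega
      rw [coeff_rename_half, coeff_rename_half, ← Finsupp.image_prodMap_embDomain_antidiagonal,
        Finset.sum_image]
      · refine Finset.sum_congr rfl fun p _ => hf _ _ ?_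
        rw [Prod.map_fst, Prod.map_snd, Finsupp.embDomain_eq_mapDomain,
          Finsupp.embDomain_eq_mapDomain, mergeExponents_mapDomain,
          ← exponentWord_embDomain ⟨_, he2.injective⟩ he2 (mergeExponents p.1 p.2),
          Finsupp.embDomain_eq_mapDomain]
        rfl
      · exact ((Finsupp.embDomain_injective e).prodMap
          (Finsupp.embDomain_injective e)).injOn
    intro m m' h
    rw [← embDomain_packedMonomial m, ← embDomain_packedMonomial m',
      key _ (spread_strictMono _), key _ (spread_strictMono _), h]

/-- The algebra endomorphism `f(x₀, x₁, …) ↦ f(x₀, x₀, x₁, x₁, …)` of `𝒬`. -/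
def psiAlgHom : QSym →ₐ[ℚ] QSym :=
  ((MvPowerSeries.rename (fun i : ℕ => i / 2)).comp qsymSubalgebra.val).codRestrict
    qsymSubalgebra rename_half_mem

/-- The list `[p₀, q₀, p₁, q₁, …]`, for lists `p` and `q` of the same length. -/
def interleave : List ℕ → List ℕ → List ℕ
  | a :: p, b :: q => a :: b :: interleave p q
  | _, _ => []

theorem packedMonomial_interleave (p q : List ℕ) (h : p.length = q.length) :
    packedMonomial (interleave p q) = mergeExponents (packedMonomial p) (packedMonomial q) := by
  have key : ∀ i, packedMonomial (interleave p q) (2 * i) = packedMonomial p i ∧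
      packedMonomial (interleave p q) (2 * i + 1) = packedMonomial q i := by
    induction p generalizing q with
    | nil =>
      cases q with
      | nil => simp [interleave, packedMonomial_nil]
      | cons b q => simp at h
    | cons a p ih =>
      cases q with
      | nil => simp at h
      | cons b q =>
        intro i
        cases i with
        | zero => exact ⟨rfl, rfl⟩
        | succ i =>
          rw [packedMonomial_cons_succ, packedMonomial_cons_succ, interleave]
          exact ih q (by simpa using h) i
  exact eq_mergeExponents (fun i => (key i).1) fun i => (key i).2

/-- This compatibility with concatenation is what makes `Ψ₂` a coalgebra map. -/
theorem interleave_append (p q p' q' : List ℕ) (h : p.length = q.length) :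
    interleave (p ++ p') (q ++ q') = interleave p q ++ interleave p' q' := by
  induction p generalizing q with
  | nil =>
    cases q with
    | nil => rfl
    | cons b q => simp at h
  | cons a p ih =>
    cases q with
    | nil => simp at h
    | cons b q => simp [interleave, ih q (by simpa using h)]

theorem sum_interleave (p q : List ℕ) (h : p.length = q.length) :
    (interleave p q).sum = p.sum + q.sum := by
  induction p generalizing q with
  | nil =>
    cases q with
    | nil => rfl
    | cons b q => simp at h
  | cons a p ih =>
    cases q with
    | nil => simp at h
    | cons b q =>
      simp only [interleave, List.sum_cons, ih q (by simpa using h)]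
      omega

/-- A monomial of `f` contributes to `x_0^{a₁} x_1^{a₂} ⋯` in `f(x₀, x₀, x₁, x₁, …)` if its
exponents at the places `2 i` and `2 i + 1` add up to `a_{i+1}`. -/
theorem coeffAt_psi (l : List ℕ) (f : QSym) :
    coeffAt l (psiAlgHom f) = ∑ x ∈ listAntidiagonal l, coeffAt (interleave x.1 x.2) f := by
  refine (coeff_rename_half _ _).trans ?_
  rw [sum_antidiagonal_packedMonomial]
  refine Finset.sum_congr rfl fun x hx => ?_
  have hx := length_of_mem_listAntidiagonal hx
  rw [coeffAt_apply, packedMonomial_interleave _ _ (hx.1.trans hx.2.symm)]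
  rfl

theorem sum_listAntidiagonal_append {V : Type*} [AddCommMonoid V] (φ : List ℕ × List ℕ → V)
    (l l' : List ℕ) :
    ∑ x ∈ listAntidiagonal (l ++ l'), φ x =
      ∑ x ∈ listAntidiagonal l, ∑ y ∈ listAntidiagonal l', φ (x.1 ++ y.1, x.2 ++ y.2) := by
  induction l generalizing φ with
  | nil => simp [sum_listAntidiagonal_nil]
  | cons a l ih =>
    rw [List.cons_append, sum_listAntidiagonal_cons, sum_listAntidiagonal_cons]
    refine Finset.sum_congr rfl fun p _ => ?_
    rw [ih]
    rfl

theorem convolution_sum {ι κ : Type*} (s : Finset ι) (t : Finset κ) (V : ι → QSym →ₗ[ℚ] ℚ)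
    (W : κ → QSym →ₗ[ℚ] ℚ) :
    convolution (∑ i ∈ s, V i) (∑ j ∈ t, W j) = ∑ i ∈ s, ∑ j ∈ t, convolution (V i) (W j) := by
  refine linearMap_ext_monomial fun n α => ?_
  simp only [LinearMap.sum_apply, convolution_monomialQSym, Finset.sum_mul_sum]
  rw [Finset.sum_comm]
  refine Finset.sum_congr rfl fun i _ => ?_
  rw [Finset.sum_comm]

theorem coeffAt_comp_psi (l : List ℕ) :
    coeffAt l ∘ₗ psiAlgHom.toLinearMap =
      ∑ x ∈ listAntidiagonal l, coeffAt (interleave x.1 x.2) := by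
  ext f
  rw [LinearMap.sum_apply]
  exact coeffAt_psi l f

theorem convolution_apply_comul (V W : QSym →ₗ[ℚ] ℚ) (f : QSym) :
    LinearMap.mul' ℚ ℚ (TensorProduct.map V W (CoalgebraStruct.comul f)) = convolution V W f := rfl

theorem psi_comul : TensorProduct.map psiAlgHom.toLinearMap psiAlgHom.toLinearMap ∘ₗ
    CoalgebraStruct.comul = CoalgebraStruct.comul ∘ₗ psiAlgHom.toLinearMap := by
  ext f
  refine tensor_ext fun l l' _ _ => ?_
  rw [LinearMap.comp_apply, LinearMap.comp_apply, convolution_apply_comul, convolution_coeffAt,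
    ← LinearMap.comp_apply (TensorProduct.map _ _), ← TensorProduct.map_comp,
    convolution_apply_comul, coeffAt_comp_psi, coeffAt_comp_psi, convolution_sum,
    ← LinearMap.comp_apply (coeffAt _), coeffAt_comp_psi, sum_listAntidiagonal_append]
  congr 1
  refine Finset.sum_congr rfl fun x hx => Finset.sum_congr rfl fun y _ => ?_
  have hx := length_of_mem_listAntidiagonal hx
  rw [convolution_coeffAt, interleave_append _ _ _ _ (hx.1.trans hx.2.symm)]

/-- The endomorphism `f(x₀, x₁, …) ↦ f(x₀, x₀, x₁, x₁, …)` of the bialgebra `𝒬`. -/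
def psiTwo : QSym →ₐc[ℚ] QSym where
  toFun := psiAlgHom
  map_add' := map_add psiAlgHom
  map_smul' := map_smul psiAlgHom
  map_one' := map_one psiAlgHom
  map_mul' := map_mul psiAlgHom
  counit_comp := by
    rw [counit_eq_coeffAt]
    ext f
    exact (coeffAt_psi [] f).trans (sum_listAntidiagonal_nil _)
  map_comp_comul := psi_comul

theorem sum_filter_pos (l : List ℕ) : (l.filter (0 < ·)).sum = l.sum := by
  induction l with
  | nil => rfl
  | cons a l ih =>
    rw [List.filter_cons]
    split_ifs with ha
    · simp [ih]
    · simp only [decide_eq_true_eq, not_lt, nonpos_iff_eq_zero] at ha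
      simp [ih, ha]

theorem mem_QSymDegree_iff {n : ℕ} {f : QSym} :
    f ∈ QSymDegree n ↔ ∀ l : List ℕ, coeffAt l f ≠ 0 → l.sum = n := by
  constructor
  · intro h l hl
    by_contra hne
    apply hl
    clear hl
    induction h using Submodule.span_induction with
    | mem x hx =>
      obtain ⟨α, rfl⟩ := hx
      rw [coeffAt_monomialQSym, if_neg]
      intro h
      apply hne
      rw [← α.blocks_sum, ← h, sum_filter_pos]
    | zero => simp
    | add x y _ _ hx hy => rw [map_add, hx, hy, add_zero]
    | smul a x _ hx => rw [map_smul, hx, smul_zero]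
  · intro h
    rw [← monomialBasis.linearCombination_repr f, Finsupp.linearCombination_apply]
    refine Submodule.sum_mem _ fun a ha => Submodule.smul_mem _ _ ?_
    rw [Finsupp.mem_support_iff, ← Module.Basis.coord_apply, monomialBasis_coord] at ha
    obtain ⟨k, α⟩ := a
    obtain rfl : k = n := by rw [← h _ ha, α.blocks_sum]
    rw [monomialBasis_apply]
    exact Submodule.subset_span ⟨α, rfl⟩

theorem monomialQSym_mem {n : ℕ} (α : Composition n) : monomialQSym α ∈ QSymDegree n :=
  Submodule.subset_span ⟨α, rfl⟩

theorem coeffAt_eq_zero_of_mem {n : ℕ} {f : QSym} (hf : f ∈ QSymDegree n) {l : List ℕ}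
    (hl : l.sum ≠ n) : coeffAt l f = 0 :=
  not_not.1 (mt (mem_QSymDegree_iff.1 hf l) hl)

theorem psi_mem_QSymDegree {n : ℕ} {f : QSym} (hf : f ∈ QSymDegree n) :
    psiAlgHom f ∈ QSymDegree n := by
  rw [mem_QSymDegree_iff]
  intro l hl
  rw [coeffAt_psi] at hl
  obtain ⟨x, hx, hne⟩ := Finset.exists_ne_zero_of_sum_ne_zero hl
  have hlen := length_of_mem_listAntidiagonal hx
  rw [← sum_of_mem_listAntidiagonal hx, ← sum_interleave _ _ (hlen.1.trans hlen.2.symm)]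
  exact mem_QSymDegree_iff.1 hf _ hne

theorem mul_mem_QSymDegree {m n : ℕ} {f g : QSym} (hf : f ∈ QSymDegree m)
    (hg : g ∈ QSymDegree n) : f * g ∈ QSymDegree (m + n) := by
  rw [mem_QSymDegree_iff]
  intro l hl
  rw [coeffAt_mul] at hl
  obtain ⟨x, hx, hne⟩ := Finset.exists_ne_zero_of_sum_ne_zero hl
  rw [← sum_of_mem_listAntidiagonal hx, mem_QSymDegree_iff.1 hf _ (left_ne_zero_of_mul hne),
    mem_QSymDegree_iff.1 hg _ (right_ne_zero_of_mul hne)]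

theorem universalCharacter_monomialQSym {n : ℕ} (α : Composition n) :
    universalCharacter (monomialQSym α) = if α.length ≤ 1 then 1 else 0 := by
  have h : monomialQSym α = monomialBasis ⟨n, α⟩ := by simp
  rw [h]
  exact monomialBasis.constr_basis ℚ _ _

/-- On `𝒬_n` the universal character is the coefficient of `x_0 ^ n`. -/
theorem universalCharacter_of_mem {n : ℕ} {f : QSym} (hf : f ∈ QSymDegree n) :
    universalCharacter f = coeffAt [n] f := by
  induction hf using Submodule.span_induction with
  | mem x hx =>
    obtain ⟨α, rfl⟩ := hx
    rw [universalCharacter_monomialQSym, coeffAt_monomialQSym]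
    refine if_congr ?_ rfl rfl
    have hs := α.blocks_sum
    have hp := fun i => α.blocks_pos (i := i)
    rw [Composition.length]
    rcases h : α.blocks with _ | ⟨a, _ | ⟨b, t⟩⟩
    · rw [h] at hs
      simp [← hs]
    · rw [h] at hs hp
      have := hp a (by simp)
      simp only [List.sum_cons, List.sum_nil, add_zero] at hs
      simp [← hs, this]
    · rw [h] at hs hp
      refine iff_of_false (by simp) fun hh => ?_
      have := congrArg List.length hh
      have h2 := List.length_filter_le (fun x => decide (0 < x)) [n]
      simp only [List.length_cons, List.length_nil] at this h2
      omega
  | zero => simp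
  | add x y _ _ hx hy => rw [map_add, map_add, hx, hy]
  | smul a x _ hx => rw [map_smul, map_smul, hx]

theorem convolution_universalCharacter_of_mem {n : ℕ} {f : QSym} (hf : f ∈ QSymDegree n) :
    convolution universalCharacter universalCharacter f =
      ∑ p ∈ Finset.HasAntidiagonal.antidiagonal n, coeffAt [p.1, p.2] f := by
  induction hf using Submodule.span_induction with
  | mem x hx =>
    obtain ⟨α, rfl⟩ := hx
    have h : ∀ p : ℕ × ℕ, coeffAt [p.1, p.2] (monomialQSym α) =
        ∑ i ∈ Finset.range (α.length + 1), coeffAt [p.1] (monomialQSym (compositionTake α i)) *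
          coeffAt [p.2] (monomialQSym (compositionDrop α i)) := fun p => by
      rw [← convolution_monomialQSym, convolution_coeffAt]
      rfl
    simp only [h]
    rw [convolution_monomialQSym, Finset.sum_comm]
    refine Finset.sum_congr rfl fun i _ => ?_
    rw [Finset.sum_eq_single ((α.blocks.take i).sum, (α.blocks.drop i).sum)]
    · rw [universalCharacter_of_mem (monomialQSym_mem _),
        universalCharacter_of_mem (monomialQSym_mem _)]
    · intro p hp hne
      rw [Finset.HasAntidiagonal.mem_antidiagonal] at hp
      rw [coeffAt_eq_zero_of_mem (monomialQSym_mem _), zero_mul]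
      rintro h1
      have h2 := List.sum_take_add_sum_drop α.blocks i
      rw [α.blocks_sum] at h2
      simp only [List.sum_cons, List.sum_nil, add_zero] at h1
      exact hne (Prod.ext h1 (by dsimp only; omega))
    · intro h
      rw [Finset.HasAntidiagonal.mem_antidiagonal] at h
      exact absurd ((List.sum_take_add_sum_drop α.blocks i).trans α.blocks_sum) h
  | zero => simp
  | add x y _ _ hx hy => simp only [map_add, hx, hy, Finset.sum_add_distrib]
  | smul a x _ hx => simp only [map_smul, hx, Finset.smul_sum]

theorem universalCharacter_comp_psi :
    universalCharacter ∘ₗ psiAlgHom.toLinearMap =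
      convolution universalCharacter universalCharacter := by
  refine linearMap_ext_monomial fun n α => ?_
  rw [convolution_universalCharacter_of_mem (monomialQSym_mem α), LinearMap.comp_apply,
    AlgHom.toLinearMap_apply, universalCharacter_of_mem (psi_mem_QSymDegree (monomialQSym_mem α)),
    coeffAt_psi, sum_listAntidiagonal_cons]
  simp only [sum_listAntidiagonal_nil, interleave]

theorem isPsiTwo_psiTwo : IsPsiTwo psiTwo :=
  ⟨fun _ _ hf => psi_mem_QSymDegree hf,
    fun f => LinearMap.congr_fun universalCharacter_comp_psi f⟩

theorem convolution_comp (V W : QSym →ₗ[ℚ] ℚ) (Φ : QSym →ₐc[ℚ] QSym) (f : QSym) :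
    convolution V W (Φ f) =
      convolution (V ∘ₗ (Φ : QSym →ₗ[ℚ] QSym)) (W ∘ₗ (Φ : QSym →ₗ[ℚ] QSym)) f := by
  have h := LinearMap.congr_fun (CoalgHomClass.map_comp_comul Φ) f
  simp only [convolution, LinearMap.comp_apply] at h ⊢
  rw [TensorProduct.map_comp, LinearMap.comp_apply]
  exact congrArg (fun z => LinearMap.mul' ℚ ℚ (TensorProduct.map V W z)) h.symm

/-- A degree-preserving bialgebra endomorphism is determined by its composite with the universal
character: the coefficient of `M_{(a, b, …)}` is the convolution of the functionals `[x_0 ^ a]`,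
`[x_0 ^ b]`, …, each of which is the universal character restricted to one degree. -/
theorem IsPsiTwo.unique {Φ Φ' : QSym →ₐc[ℚ] QSym} (h : IsPsiTwo Φ) (h' : IsPsiTwo Φ') :
    Φ = Φ' := by
  have single : ∀ a, coeffAt [a] ∘ₗ (Φ : QSym →ₗ[ℚ] QSym) =
      coeffAt [a] ∘ₗ (Φ' : QSym →ₗ[ℚ] QSym) := by
    intro a
    refine linearMap_ext_monomial fun n α => ?_
    have hm := h.1 n _ (monomialQSym_mem α)
    have hm' := h'.1 n _ (monomialQSym_mem α)
    change coeffAt [a] (Φ _) = coeffAt [a] (Φ' _)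
    by_cases ha : a = n
    · subst ha
      rw [← universalCharacter_of_mem hm, ← universalCharacter_of_mem hm', h.2, h'.2]
    · rw [coeffAt_eq_zero_of_mem hm (by simpa using ha),
        coeffAt_eq_zero_of_mem hm' (by simpa using ha)]
  have key : ∀ l, coeffAt l ∘ₗ (Φ : QSym →ₗ[ℚ] QSym) =
      coeffAt l ∘ₗ (Φ' : QSym →ₗ[ℚ] QSym) := by
    intro l
    induction l with
    | nil =>
      rw [← counit_eq_coeffAt]
      exact (CoalgHomClass.counit_comp Φ).trans (CoalgHomClass.counit_comp Φ').symm
    | cons a l ih =>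
      ext f
      change coeffAt ([a] ++ l) (Φ f) = coeffAt ([a] ++ l) (Φ' f)
      rw [← convolution_coeffAt, convolution_comp, convolution_comp, ih, single]
  refine DFunLike.ext _ _ fun f => qsym_ext fun l _ => ?_
  exact LinearMap.congr_fun (key l) f

theorem universalCharacter_mul (f g : QSym) :
    universalCharacter (f * g) = universalCharacter f * universalCharacter g := by
  have h : (LinearMap.mul ℚ QSym).compr₂ universalCharacter =
      (LinearMap.mul ℚ ℚ).compl₁₂ universalCharacter universalCharacter := by
    refine linearMap_ext_monomial fun m α => linearMap_ext_monomial fun n β => ?_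
    simp only [LinearMap.compr₂_apply, LinearMap.mul_apply', LinearMap.compl₁₂_apply]
    rw [universalCharacter_of_mem (mul_mem_QSymDegree (monomialQSym_mem α) (monomialQSym_mem β)),
      universalCharacter_of_mem (monomialQSym_mem α),
      universalCharacter_of_mem (monomialQSym_mem β), coeffAt_mul, sum_listAntidiagonal_cons]
    simp only [sum_listAntidiagonal_nil]
    rw [Finset.sum_eq_single (m, n)]
    · intro p hp hne
      rw [Finset.HasAntidiagonal.mem_antidiagonal] at hp
      rw [coeffAt_eq_zero_of_mem (monomialQSym_mem α), zero_mul]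
      intro h
      simp only [List.sum_cons, List.sum_nil, add_zero] at h
      exact hne (Prod.ext h (by dsimp only; omega))
    · intro h
      simp at h
  exact LinearMap.congr_fun₂ h f g

theorem monomialQSym_nil {n : ℕ} (α : Composition n) (h : α.blocks = []) :
    monomialQSym α = 1 := by
  classical
  apply Subtype.ext
  ext m
  rw [coeff_monomialQSym, OneMemClass.coe_one, MvPowerSeries.coeff_one, h]
  refine if_congr ?_ rfl rfl
  simp [exponentWord, ← Finsupp.support_eq_empty, ← List.length_eq_zero_iff]

theorem universalCharacter_one : universalCharacter 1 = 1 := by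
  rw [← monomialQSym_nil (Composition.ones 0) rfl, universalCharacter_monomialQSym]
  rfl

/-- The multiplicative functional `X ⋆ X = X ∘ Ψ₂`, that is, `f ↦ f(1, 1, 0, 0, …)`. -/
def characterSquare : QSym →ₐ[ℚ] ℚ :=
  (AlgHom.ofLinearMap universalCharacter universalCharacter_one universalCharacter_mul).comp
    psiAlgHom

theorem characterSquare_toLinearMap :
    characterSquare.toLinearMap = convolution universalCharacter universalCharacter :=
  universalCharacter_comp_psi

/-! ### Chain sums of graded posets -/

/-- The values of `f` at the successive pairs of neighbours in a list. -/
def steps {P β : Type*} (f : P → P → β) (L : List P) : List β := List.zipWith f L L.tail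

theorem ofFn_steps {P β : Type*} [Preorder P] (f : P → P → β) (c : LTSeries P) :
    (List.ofFn fun i : Fin c.length => f (c i.castSucc) (c i.succ)) = steps f c.toList := by
  refine List.ext_getElem (by simp [steps]) fun i h1 h2 => ?_
  simp only [steps, RelSeries.toList, List.getElem_zipWith, List.getElem_tail, List.getElem_ofFn]
  rfl

theorem steps_cons {P β : Type*} [Preorder P] (f : P → P → β) (s u : P) (c : LTSeries P)
    (hc : c.head = u) :
    steps f (s :: c.toList) = f s u :: steps f c.toList := by
  obtain ⟨r, hr⟩ : ∃ r, c.toList = u :: r := by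
    refine ⟨c.toList.tail, ?_⟩
    rw [← hc, ← RelSeries.head_toList]
    exact (List.cons_head_tail c.toList_ne_nil).symm
  rw [hr]
  rfl

open Classical in
theorem sum_chainsBetween {P : Type} [PartialOrder P] [Fintype P] {V : Type*} [AddCommMonoid V] (φ : List P → V)
    (s t : P) :
    ∑ c ∈ chainsBetween s t, φ c.toList = (if s = t then φ [s] else 0) +
      ∑ u : P, if s < u then ∑ c ∈ chainsBetween u t, φ (s :: c.toList) else 0 := by
  classical
  rw [← Finset.sum_filter_add_sum_filter_not (chainsBetween s t) (fun c => c.length = 0)]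
  congr 1
  · have h0 : ∀ c : LTSeries P, c.length = 0 → c.head = s → c = RelSeries.singleton _ s := by
      intro c h1 h2
      apply RelSeries.toList_injective
      have hl : c.toList.length = 1 := by rw [RelSeries.length_toList, h1]
      obtain ⟨x, hx⟩ := List.length_eq_one_iff.1 hl
      rw [RelSeries.toList_singleton, hx, ← h2, ← RelSeries.head_toList]
      simp [hx]
    split_ifs with hst
    · subst hst
      rw [Finset.sum_eq_single (RelSeries.singleton _ s)]
      · rw [RelSeries.toList_singleton]
      · intro c hc hne
        simp only [chainsBetween, Finset.mem_filter] at hc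
        exact absurd (h0 c hc.2 hc.1.2.1) hne
      · intro h
        simp only [chainsBetween, Finset.mem_filter, Finset.mem_univ, true_and] at h
        exact absurd ⟨⟨rfl, rfl⟩, rfl⟩ h
    · refine Finset.sum_eq_zero fun c hc => ?_
      simp only [chainsBetween, Finset.mem_filter] at hc
      have := h0 c hc.2 hc.1.2.1
      rw [this] at hc
      exact absurd hc.1.2.2 hst
  · rw [← Finset.sum_filter, Finset.sum_sigma']
    symm
    refine Finset.sum_bij' (fun x hx => x.2.cons s (by
        simp only [chainsBetween, Finset.mem_sigma, Finset.mem_filter] at hx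
        rw [hx.2.2.1]
        exact hx.1.2))
      (fun c hc => ⟨(c.tail (by simpa using (Finset.mem_filter.1 hc).2)).head,
        c.tail (by simpa using (Finset.mem_filter.1 hc).2)⟩) ?_ ?_ ?_ ?_ ?_
    · intro x hx
      simp only [chainsBetween, Finset.mem_sigma, Finset.mem_filter, Finset.mem_univ,
        true_and] at hx ⊢
      refine ⟨⟨RelSeries.head_cons _ _ _, ?_⟩, by simp⟩
      rw [RelSeries.last_cons]
      exact hx.2.2
    · intro c hc
      simp only [chainsBetween, Finset.mem_sigma, Finset.mem_filter, Finset.mem_univ,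
        true_and] at hc ⊢
      refine ⟨?_, ?_⟩
      · refine hc.1.1.symm.trans_lt ?_
        exact c.step ⟨0, Nat.pos_of_ne_zero hc.2⟩
      · rw [RelSeries.last_tail]
        exact hc.1.2
    · rintro ⟨u, c⟩ hx
      simp only [chainsBetween, Finset.mem_sigma, Finset.mem_filter, Finset.mem_univ,
        true_and] at hx
      obtain ⟨-, rfl, -⟩ := hx
      simp only [RelSeries.tail_cons]
    · intro c hc
      simp only [chainsBetween, Finset.mem_filter, Finset.mem_univ,
        true_and] at hc
      obtain ⟨⟨rfl, -⟩, h0⟩ := hc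
      exact RelSeries.cons_self_tail h0
    · intro x hx
      rw [RelSeries.toList_cons]

section ChainSums

variable {P : Type} [PartialOrder P] [GradeMinOrder ℕ P]

/-- The sum `∑ w(t₀,t₁) ⋯ w(t_{k-1},t_k) M_{(ρ(t₀,t₁), …, ρ(t_{k-1},t_k))}` over the chains
`s = t₀ < t₁ < ⋯ < t_k = t`. -/
def chainSum [Fintype P] (w : P → P → ℚ) (s t : P) : QSym :=
  ∑ c ∈ chainsBetween s t, (∏ i : Fin c.length, w (c i.castSucc) (c i.succ)) •
    monomialQSym (chainType c)

theorem intervalQSym_eq_chainSum [Fintype P] (s t : P) :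
    intervalQSym s t = chainSum (fun _ _ => 1) s t := by
  simp [intervalQSym, chainSum]

theorem coeffAt_chainSum [Fintype P] (w : P → P → ℚ) (s t : P) {l : List ℕ}
    (hl : ∀ a ∈ l, 0 < a) :
    coeffAt l (chainSum w s t) = ∑ c ∈ chainsBetween s t,
      if l = steps (fun x y => grade ℕ y - grade ℕ x) c.toList then
        (steps w c.toList).prod else 0 := by
  rw [chainSum, map_sum]
  refine Finset.sum_congr rfl fun c _ => ?_
  rw [map_smul, coeffAt_monomialQSym, filter_eq_self_of_pos hl, chainType]
  simp only [ofFn_steps (fun x y => grade ℕ y - grade ℕ x)]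
  rw [← ofFn_steps w, List.prod_ofFn]
  simp

open Classical in
theorem coeffAt_chainSum_nil [Fintype P] (w : P → P → ℚ) (s t : P) :
    coeffAt [] (chainSum w s t) = if s = t then 1 else 0 := by
  rw [coeffAt_chainSum _ _ _ (by simp), sum_chainsBetween (fun L =>
    if [] = steps (fun x y => grade ℕ y - grade ℕ x) L then (steps w L).prod else 0),
    Finset.sum_eq_zero]
  · simp [steps]
  · intro u _
    rw [ite_eq_right_iff]
    intro _
    refine Finset.sum_eq_zero fun c hc => if_neg ?_
    simp only [chainsBetween, Finset.mem_filter] at hc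
    rw [steps_cons _ _ _ _ hc.2.1]
    simp

open Classical in
/-- The first step of a chain gives a recursion for the coefficients of its chain sums. -/
theorem coeffAt_chainSum_cons [Fintype P] (w : P → P → ℚ) (s t : P) {a : ℕ}
    {l : List ℕ} (ha : 0 < a) (hl : ∀ b ∈ l, 0 < b) :
    coeffAt (a :: l) (chainSum w s t) = ∑ u : P,
      if s ≤ u ∧ grade ℕ u - grade ℕ s = a then w s u * coeffAt l (chainSum w u t) else 0 := by
  rw [coeffAt_chainSum _ _ _ (by simpa using ⟨ha, hl⟩), sum_chainsBetween (fun L =>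
    if a :: l = steps (fun x y => grade ℕ y - grade ℕ x) L then (steps w L).prod else 0)]
  have h0 : (if s = t then (if a :: l = steps (fun x y => grade ℕ y - grade ℕ x) [s] then
      (steps w [s]).prod else 0) else 0) = 0 := by
    simp [steps]
  rw [h0, zero_add]
  refine Finset.sum_congr rfl fun u _ => ?_
  by_cases hsu : s < u
  · rw [if_pos hsu]
    have : ∀ c ∈ chainsBetween u t,
        (if a :: l = steps (fun x y => grade ℕ y - grade ℕ x) (s :: c.toList) then
          (steps w (s :: c.toList)).prod else 0) =
        if s ≤ u ∧ grade ℕ u - grade ℕ s = a then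
          w s u * (if l = steps (fun x y => grade ℕ y - grade ℕ x) c.toList then
            (steps w c.toList).prod else 0) else 0 := by
      intro c hc
      simp only [chainsBetween, Finset.mem_filter] at hc
      rw [steps_cons _ _ _ _ hc.2.1, steps_cons _ _ _ _ hc.2.1, List.prod_cons, mul_ite, mul_zero,
        ← ite_and]
      refine if_congr ?_ rfl rfl
      rw [List.cons.injEq, and_iff_right hsu.le, eq_comm]
    rw [Finset.sum_congr rfl this, coeffAt_chainSum _ _ _ hl]
    split_ifs
    · rw [Finset.mul_sum]
    · exact Finset.sum_const_zero
  · rw [if_neg hsu, if_neg]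
    rintro ⟨h1, h2⟩
    rcases h1.lt_or_eq with h | rfl
    · exact hsu h
    · omega

open Classical in
theorem coeffAt_intervalQSym_nil [Fintype P] (s t : P) :
    coeffAt [] (intervalQSym s t) = if s = t then 1 else 0 := by
  rw [intervalQSym_eq_chainSum, coeffAt_chainSum_nil]

open Classical in
theorem coeffAt_intervalQSym_cons [Fintype P] (s t : P) {a : ℕ} {l : List ℕ} (ha : 0 < a)
    (hl : ∀ b ∈ l, 0 < b) :
    coeffAt (a :: l) (intervalQSym s t) = ∑ u : P,
      if s ≤ u ∧ grade ℕ u - grade ℕ s = a then coeffAt l (intervalQSym u t) else 0 := by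
  simp only [intervalQSym_eq_chainSum, coeffAt_chainSum_cons _ _ _ ha hl, one_mul]

/-- The coproduct of `F([s,t])` is `∑ F([s,u]) ⊗ F([u,t])`, in terms of coefficients. -/
theorem coeffAt_intervalQSym_append [Fintype P] (s t : P) (l l' : List ℕ) :
    coeffAt (l ++ l') (intervalQSym s t) =
      ∑ u : P, coeffAt l (intervalQSym s u) * coeffAt l' (intervalQSym u t) := by
  classical
  have pos : ∀ (l l' : List ℕ), (∀ a ∈ l, 0 < a) → (∀ a ∈ l', 0 < a) → ∀ s : P,
      coeffAt (l ++ l') (intervalQSym s t) =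
        ∑ u : P, coeffAt l (intervalQSym s u) * coeffAt l' (intervalQSym u t) := by
    intro l l' hl hl'
    induction l with
    | nil => simp [coeffAt_intervalQSym_nil]
    | cons a l ih =>
      intro s
      simp only [List.mem_cons, forall_eq_or_imp] at hl
      have hll : ∀ b ∈ l ++ l', 0 < b := by
        intro b hb
        rcases List.mem_append.1 hb with hb | hb
        exacts [hl.2 b hb, hl' b hb]
      rw [List.cons_append, coeffAt_intervalQSym_cons _ _ hl.1 hll]
      simp only [coeffAt_intervalQSym_cons _ _ hl.1 hl.2, ih hl.2, Finset.sum_mul]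
      rw [Finset.sum_comm]
      refine Finset.sum_congr rfl fun u _ => ?_
      split_ifs <;> simp
  have hp : ∀ l : List ℕ, ∀ a ∈ l.filter (0 < ·), 0 < a := fun l a ha => by
    simpa using (List.mem_filter.1 ha).2
  rw [← coeffAt_filter, List.filter_append, pos _ _ (hp l) (hp l')]
  simp only [coeffAt_filter]

theorem grade_of_coeffAt_ne_zero [Fintype P] {s t : P} {l : List ℕ}
    (h : coeffAt l (intervalQSym s t) ≠ 0) : s ≤ t ∧ l.sum = grade ℕ t - grade ℕ s := by
  classical
  have pos : ∀ l : List ℕ, (∀ a ∈ l, 0 < a) → ∀ s : P, coeffAt l (intervalQSym s t) ≠ 0 →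
      s ≤ t ∧ l.sum = grade ℕ t - grade ℕ s := by
    intro l hl
    induction l with
    | nil =>
      intro s h
      rw [coeffAt_intervalQSym_nil, ite_ne_right_iff] at h
      obtain ⟨rfl, -⟩ := h
      simp
    | cons a l ih =>
      intro s h
      simp only [List.mem_cons, forall_eq_or_imp] at hl
      rw [coeffAt_intervalQSym_cons _ _ hl.1 hl.2] at h
      obtain ⟨u, -, hu⟩ := Finset.exists_ne_zero_of_sum_ne_zero h
      rw [ite_ne_right_iff] at hu
      obtain ⟨⟨h1, h2⟩, h3⟩ := hu
      obtain ⟨h4, h5⟩ := ih hl.2 u h3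
      have h6 : grade ℕ s ≤ grade ℕ u := grade_mono h1
      have h7 : grade ℕ u ≤ grade ℕ t := grade_mono h4
      exact ⟨h1.trans h4, by rw [List.sum_cons]; omega⟩
  rw [← coeffAt_filter] at h
  rw [← sum_filter_pos]
  exact pos _ (fun a ha => by simpa using (List.mem_filter.1 ha).2) s h

theorem intervalQSym_mem [Fintype P] (s t : P) :
    intervalQSym s t ∈ QSymDegree (grade ℕ t - grade ℕ s) :=
  mem_QSymDegree_iff.2 fun _ h => (grade_of_coeffAt_ne_zero h).2

open Classical in
theorem coeffAt_singleton_intervalQSym [Fintype P] (s t : P) (a : ℕ) :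
    coeffAt [a] (intervalQSym s t) = if s ≤ t ∧ grade ℕ t - grade ℕ s = a then 1 else 0 := by
  rcases Nat.eq_zero_or_pos a with rfl | ha
  · rw [coeffAt_congr (l' := []) (by simp), coeffAt_intervalQSym_nil]
    refine if_congr ⟨?_, ?_⟩ rfl rfl
    · rintro rfl
      simp
    · rintro ⟨h1, h2⟩
      rcases h1.lt_or_eq with h | h
      · have : grade ℕ s < grade ℕ t := grade_strictMono h
        omega
      · exact h
  · rw [coeffAt_intervalQSym_cons _ _ ha (by simp)]
    simp only [coeffAt_intervalQSym_nil]
    rw [Finset.sum_eq_single t]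
    · simp
    · intro u _ hu
      simp [hu]
    · simp

open Classical in
theorem sum_coeffAt_pair_intervalQSym [Fintype P] (s t : P) (a : ℕ) :
    ∑ p ∈ Finset.HasAntidiagonal.antidiagonal a, coeffAt [p.1, p.2] (intervalQSym s t) =
      if s ≤ t ∧ grade ℕ t - grade ℕ s = a then
        ((Finset.univ.filter fun u : P => s ≤ u ∧ u ≤ t).card : ℚ) else 0 := by
  have h : ∀ p : ℕ × ℕ, coeffAt [p.1, p.2] (intervalQSym s t) = ∑ u : P,
      if s ≤ u ∧ u ≤ t ∧ grade ℕ u - grade ℕ s = p.1 ∧ grade ℕ t - grade ℕ u = p.2 then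
        1 else 0 := by
    intro p
    refine (coeffAt_intervalQSym_append s t [p.1] [p.2]).trans (Finset.sum_congr rfl fun u _ => ?_)
    rw [coeffAt_singleton_intervalQSym, coeffAt_singleton_intervalQSym, mul_ite, mul_one, mul_zero,
      ← ite_and]
    exact if_congr (by tauto) rfl rfl
  simp only [h]
  rw [Finset.sum_comm, Finset.card_filter, Nat.cast_sum]
  have h2 : ∀ u : P, (∑ p ∈ Finset.HasAntidiagonal.antidiagonal a,
      if s ≤ u ∧ u ≤ t ∧ grade ℕ u - grade ℕ s = p.1 ∧ grade ℕ t - grade ℕ u = p.2 then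
        (1 : ℚ) else 0) =
      if (s ≤ u ∧ u ≤ t) ∧ grade ℕ t - grade ℕ s = a then 1 else 0 := by
    intro u
    by_cases hu : s ≤ u ∧ u ≤ t
    · have h6 : grade ℕ s ≤ grade ℕ u := grade_mono hu.1
      have h7 : grade ℕ u ≤ grade ℕ t := grade_mono hu.2
      by_cases ha : grade ℕ t - grade ℕ s = a
      · rw [if_pos ⟨hu, ha⟩, Finset.sum_eq_single (grade ℕ u - grade ℕ s, grade ℕ t - grade ℕ u)]
        · simp [hu]
        · intro p _ hp
          rw [if_neg]
          rintro ⟨-, -, h3, h4⟩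
          exact hp (Prod.ext h3.symm h4.symm)
        · intro hn
          rw [Finset.HasAntidiagonal.mem_antidiagonal] at hn
          exact absurd (by dsimp only; omega) hn
      · rw [if_neg (by tauto)]
        refine Finset.sum_eq_zero fun p hp => if_neg ?_
        rw [Finset.HasAntidiagonal.mem_antidiagonal] at hp
        rintro ⟨-, -, h3, h4⟩
        omega
    · rw [if_neg (by tauto)]
      exact Finset.sum_eq_zero fun p _ => if_neg (by tauto)
  rw [Finset.sum_congr rfl fun u _ => h2 u]
  by_cases ha : grade ℕ t - grade ℕ s = a
  · simp only [ha, and_true]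
    split_ifs with hst
    · exact Finset.sum_congr rfl fun u _ => by split_ifs <;> simp
    · exact Finset.sum_eq_zero fun u _ => if_neg fun hu => hst (hu.1.trans hu.2)
  · simp [ha]

open Classical in
theorem characterSquare_intervalQSym [Fintype P] {s t : P} (h : s ≤ t) :
    characterSquare (intervalQSym s t) =
      ((Finset.univ.filter fun u : P => s ≤ u ∧ u ≤ t).card : ℚ) := by
  rw [← AlgHom.toLinearMap_apply, characterSquare_toLinearMap,
    convolution_universalCharacter_of_mem (intervalQSym_mem s t), sum_coeffAt_pair_intervalQSym,
    if_pos ⟨h, rfl⟩]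

/-- Both sides satisfy the same recursion on the first step of a chain: the two exponents that `Ψ₂`
adds up to the first part `a` are `ρ(s,v)` and `ρ(v,u)` for some `v` in an interval `[s,u]` of
length `a`, so that the weight of the first step is the number of elements of `[s,u]`. -/
theorem psi_intervalQSym [Fintype P] (s t : P) :
    psiAlgHom (intervalQSym s t) =
      chainSum (fun x y => characterSquare (intervalQSym x y)) s t := by
  classical
  refine qsym_ext fun l hl => ?_
  induction l generalizing s with
  | nil =>
    rw [coeffAt_psi, sum_listAntidiagonal_nil, coeffAt_chainSum_nil]
    exact coeffAt_intervalQSym_nil s t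
  | cons a l ih =>
    simp only [List.mem_cons, forall_eq_or_imp] at hl
    rw [coeffAt_chainSum_cons _ _ _ hl.1 hl.2, coeffAt_psi, sum_listAntidiagonal_cons]
    have h : ∀ (p : ℕ × ℕ) (x : List ℕ × List ℕ),
        coeffAt (interleave (p.1 :: x.1) (p.2 :: x.2)) (intervalQSym s t) =
        ∑ u : P, coeffAt [p.1, p.2] (intervalQSym s u) *
          coeffAt (interleave x.1 x.2) (intervalQSym u t) :=
      fun p x => coeffAt_intervalQSym_append s t [p.1, p.2] _
    simp only [h]
    rw [Finset.sum_congr rfl fun p _ => Finset.sum_comm, Finset.sum_comm]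
    refine Finset.sum_congr rfl fun u _ => ?_
    rw [← ih u hl.2, coeffAt_psi, ← Finset.sum_mul_sum, sum_coeffAt_pair_intervalQSym]
    split_ifs with hu
    · rw [characterSquare_intervalQSym hu.1]
    · rw [zero_mul]

end ChainSums

theorem countsElements_characterSquare : CountsElements characterSquare.toLinearMap := by
  intro P _ _ _ _
  classical
  rw [AlgHom.toLinearMap_apply, posetQSym, characterSquare_intervalQSym bot_le]
  simp

theorem isTchebyshevU_psi : IsTchebyshevU characterSquare.toLinearMap psiAlgHom.toLinearMap :=
  fun _ _ _ _ _ => psi_intervalQSym _ _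

/-! ### Level posets span `𝒬` -/

/-- The graded poset with levels `0, …, N` in which level `i` has two elements if `i ∈ T` and one
element otherwise, and any two elements of different levels are comparable. -/
def LevelPoset (N : ℕ) (T : Finset ℕ) : Type :=
  Σ i : Fin (N + 1), Fin (if (i : ℕ) ∈ T then 2 else 1)

namespace LevelPoset

variable {N : ℕ} {T : Finset ℕ}

theorem size_pos (i : ℕ) : 0 < if i ∈ T then 2 else 1 := by split_ifs <;> norm_num

instance : Fintype (LevelPoset N T) :=
  inferInstanceAs (Fintype (Σ i : Fin (N + 1), Fin (if (i : ℕ) ∈ T then 2 else 1)))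

/-- The level of an element. -/
def level (x : LevelPoset N T) : ℕ := x.1

theorem level_le (x : LevelPoset N T) : x.level ≤ N := Nat.lt_succ_iff.1 x.1.2

/-- The first element of level `i`. -/
def base (i : ℕ) (hi : i ≤ N) : LevelPoset N T := ⟨⟨i, Nat.lt_succ_of_le hi⟩, ⟨0, size_pos _⟩⟩

theorem eq_base {x : LevelPoset N T} (h : x.level ∉ T) : x = base x.level x.level_le := by
  obtain ⟨i, k⟩ := x
  refine congrArg (Sigma.mk i) (Fin.ext ?_)
  change (i : ℕ) ∉ T at h
  have := k.2.trans_eq (if_neg h)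
  change (k : ℕ) = 0
  omega

instance : PartialOrder (LevelPoset N T) where
  le x y := x = y ∨ x.level < y.level
  le_refl x := Or.inl rfl
  le_trans x y z := by
    rintro (rfl | h) (rfl | h')
    · exact Or.inl rfl
    · exact Or.inr h'
    · exact Or.inr h
    · exact Or.inr (h.trans h')
  le_antisymm x y := by
    rintro (rfl | h) (h' | h')
    · rfl
    · rfl
    · exact h'.symm
    · omega

theorem le_iff {x y : LevelPoset N T} : x ≤ y ↔ x = y ∨ x.level < y.level := Iff.rfl

theorem lt_iff {x y : LevelPoset N T} : x < y ↔ x.level < y.level := by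
  rw [lt_iff_le_and_ne, le_iff]
  constructor
  · rintro ⟨h | h, hne⟩
    · exact absurd h hne
    · exact h
  · intro h
    exact ⟨Or.inr h, by rintro rfl; omega⟩

instance : GradeMinOrder ℕ (LevelPoset N T) where
  grade := level
  grade_strictMono _ _ h := lt_iff.1 h
  covBy_grade x y h := by
    rw [Nat.covBy_iff_add_one_eq]
    have h1 := lt_iff.1 h.1
    by_contra hne
    have h2 : x.level + 1 ≤ N := by have := y.level_le; omega
    exact h.2 (c := base (x.level + 1) h2) (lt_iff.2 (Nat.lt_succ_self _))
      (lt_iff.2 (show x.level + 1 < y.level by omega))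
  isMin_grade x h := by
    rw [isMin_iff_eq_bot]
    by_contra hne
    have hlt : base 0 (Nat.zero_le N) < x := lt_iff.2 (Nat.pos_of_ne_zero hne)
    exact absurd hlt (h.not_lt)

theorem grade_eq (x : LevelPoset N T) : grade ℕ x = x.level := rfl

/-- If the extreme levels have one element each, the poset is bounded. -/
abbrev boundedOrder (hT : T ⊆ Finset.Ioo 0 N) : BoundedOrder (LevelPoset N T) where
  bot := base 0 (Nat.zero_le N)
  top := base N le_rfl
  bot_le x := by
    rcases Nat.eq_zero_or_pos x.level with h | h
    · refine Or.inl ?_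
      have h0 : x.level ∉ T := fun hm => by
        have := Finset.mem_Ioo.1 (hT hm)
        omega
      rw [eq_base h0]
      congr 1
      exact h.symm
    · exact Or.inr h
  le_top x := by
    rcases x.level_le.lt_or_eq with h | h
    · exact Or.inr h
    · refine Or.inl ?_
      have h0 : x.level ∉ T := fun hm => by
        have := Finset.mem_Ioo.1 (hT hm)
        omega
      rw [eq_base h0]
      congr 1

end LevelPoset

/-- The sums `i + a₁`, `i + a₁ + a₂`, … for a list `[a₁, a₂, …]`. -/
def partialSums : ℕ → List ℕ → Finset ℕ
  | _, [] => ∅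
  | i, a :: l => insert (i + a) (partialSums (i + a) l)

theorem bounds_of_mem_partialSums {i j : ℕ} {l : List ℕ} (hl : ∀ a ∈ l, 0 < a)
    (h : j ∈ partialSums i l) : i < j ∧ j ≤ i + l.sum := by
  induction l generalizing i with
  | nil => simp [partialSums] at h
  | cons a l ih =>
    simp only [List.mem_cons, forall_eq_or_imp] at hl
    rw [partialSums, Finset.mem_insert] at h
    rw [List.sum_cons]
    rcases h with rfl | h
    · omega
    · have := ih hl.2 h
      omega

theorem add_sum_mem_partialSums {i : ℕ} {l : List ℕ} (h : l ≠ []) :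
    i + l.sum ∈ partialSums i l := by
  induction l generalizing i with
  | nil => exact absurd rfl h
  | cons a l ih =>
    rw [partialSums, List.sum_cons, Finset.mem_insert]
    cases l with
    | nil => simp
    | cons b l => exact Or.inr (by rw [← add_assoc]; exact ih (by simp))

theorem partialSums_injective {i : ℕ} {l l' : List ℕ} (hl : ∀ a ∈ l, 0 < a)
    (hl' : ∀ a ∈ l', 0 < a) (h : partialSums i l = partialSums i l') : l = l' := by
  induction l generalizing i l' with
  | nil =>
    cases l' with
    | nil => rfl
    | cons b l' => exact absurd h.symm (Finset.insert_ne_empty _ _)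
  | cons a l ih =>
    cases l' with
    | nil => simp [partialSums] at h
    | cons b l' =>
      simp only [List.mem_cons, forall_eq_or_imp] at hl hl'
      have hmin : ∀ {a : ℕ} {l : List ℕ}, (∀ c ∈ l, 0 < c) → ∀ j ∈ partialSums i (a :: l),
          i + a ≤ j := by
        intro a l hl j hj
        rw [partialSums, Finset.mem_insert] at hj
        rcases hj with rfl | hj
        · rfl
        · exact (bounds_of_mem_partialSums hl hj).1.le
      have h1 := hmin hl.2 (i + b) (by rw [h, partialSums]; exact Finset.mem_insert_self _ _)
      have h2 := hmin hl'.2 (i + a) (by rw [← h, partialSums]; exact Finset.mem_insert_self _ _)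
      obtain rfl : a = b := by omega
      have hni : ∀ {l : List ℕ}, (∀ c ∈ l, 0 < c) → i + a ∉ partialSums (i + a) l := by
        intro l hl hm
        have := bounds_of_mem_partialSums hl hm
        omega
      rw [partialSums, partialSums] at h
      rw [ih hl.2 hl'.2 (by rw [← Finset.erase_insert (hni hl.2), h,
        Finset.erase_insert (hni hl'.2)])]

open LevelPoset

/-- The quasisymmetric function of the interval between the extreme levels of a level poset. -/
def levelQSym (N : ℕ) (T : Finset ℕ) : QSym :=
  intervalQSym (base 0 (Nat.zero_le N) : LevelPoset N T) (base N le_rfl)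

theorem coeffAt_interval_levelPoset {N : ℕ} {T : Finset ℕ} (hN : N ∉ T) {l : List ℕ}
    (hl : ∀ a ∈ l, 0 < a) (x : LevelPoset N T) :
    coeffAt l (intervalQSym x (base N le_rfl)) =
      if x.level + l.sum = N then ∏ j ∈ partialSums x.level l, (if j ∈ T then 2 else 1) else 0 := by
  classical
  induction l generalizing x with
  | nil =>
    rw [coeffAt_intervalQSym_nil]
    simp only [List.sum_nil, add_zero, partialSums, Finset.prod_empty]
    refine if_congr ⟨?_, fun h => ?_⟩ rfl rfl
    · rintro rfl
      rfl
    · refine (eq_base (x := x) (by rw [h]; exact hN)).trans ?_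
      congr 1
  | cons a l ih =>
    simp only [List.mem_cons, forall_eq_or_imp] at hl
    rw [coeffAt_intervalQSym_cons _ _ hl.1 hl.2]
    have h : ∀ y : LevelPoset N T, (if x ≤ y ∧ grade ℕ y - grade ℕ x = a then
        coeffAt l (intervalQSym y (base N le_rfl)) else 0) =
        if y.level = x.level + a then (if x.level + a + l.sum = N then
          ∏ j ∈ partialSums (x.level + a) l, (if j ∈ T then (2 : ℚ) else 1) else 0) else 0 := by
      intro y
      rw [grade_eq, grade_eq, le_iff, ih hl.2]
      by_cases hy : y.level = x.level + a
      · rw [if_pos hy, if_pos ⟨Or.inr (by omega), by omega⟩, hy]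
      · rw [if_neg hy, if_neg]
        rintro ⟨rfl | h1, h2⟩ <;> omega
    rw [Finset.sum_congr rfl fun y _ => h y, List.sum_cons, ← add_assoc]
    have hni : x.level + a ∉ partialSums (x.level + a) l := fun hm => by
      have := bounds_of_mem_partialSums hl.2 hm
      omega
    rw [partialSums, Finset.prod_insert hni]
    by_cases hs : x.level + a + l.sum = N
    · simp only [if_pos hs]
      refine (Fintype.sum_sigma _).trans ?_
      rw [Finset.sum_eq_single (⟨x.level + a, by omega⟩ : Fin (N + 1))]
      · refine (Finset.sum_congr rfl fun k _ => if_pos rfl).trans ?_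
        rw [Finset.sum_const, nsmul_eq_mul]
        congr 1
        refine (congrArg Nat.cast (Fintype.card_fin _)).trans ?_
        push_cast
        rfl
      · intro i _ hi
        refine Finset.sum_eq_zero fun k _ => if_neg fun hk => hi (Fin.ext hk)
      · intro hh
        exact absurd (Finset.mem_univ _) hh
    · simp [hs]

theorem coeffAt_levelQSym {N : ℕ} {T : Finset ℕ} (hT : T ⊆ Finset.Ioo 0 N) {l : List ℕ}
    (hl : ∀ a ∈ l, 0 < a) :
    coeffAt l (levelQSym N T) = if l.sum = N then
      ∏ j ∈ T, (if j ∈ partialSums 0 l then 2 else 1) else 0 := by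
  have hN : N ∉ T := fun h => by simpa using hT h
  rw [levelQSym, coeffAt_interval_levelPoset hN hl]
  have h0 : (base 0 (Nat.zero_le N) : LevelPoset N T).level = 0 := rfl
  rw [h0, zero_add, Finset.prod_ite_mem, Finset.prod_ite_mem, Finset.inter_comm]

/-- The `F(P)` span `𝒬`: the function `M_β` is an alternating sum of the functions of the level
posets whose levels have one or two elements.  The coefficients are the entries of a tensor power
of the inverse of the matrix with rows `(1, 1)` and `(1, 2)`. -/
theorem monomialQSym_eq_sum_levelQSym {N : ℕ} (β : Composition N) :
    monomialQSym β = ∑ T ∈ (Finset.Ioo 0 N).powerset,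
      ((∏ j ∈ T, if j ∈ partialSums 0 β.blocks then (1 : ℚ) else -1) *
        ∏ j ∈ Finset.Ioo 0 N \ T, if j ∈ partialSums 0 β.blocks then (-1 : ℚ) else 2) •
          levelQSym N T := by
  have hβ : ∀ a ∈ β.blocks, 0 < a := fun _ h => β.blocks_pos h
  refine qsym_ext fun l hl => ?_
  rw [map_sum, coeffAt_monomialQSym, filter_eq_self_of_pos hl]
  by_cases hs : l.sum = N
  · have h : ∀ T ∈ (Finset.Ioo 0 N).powerset,
        coeffAt l (((∏ j ∈ T, if j ∈ partialSums 0 β.blocks then (1 : ℚ) else -1) *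
          ∏ j ∈ Finset.Ioo 0 N \ T, if j ∈ partialSums 0 β.blocks then (-1 : ℚ) else 2) •
            levelQSym N T) =
        (∏ j ∈ T, (if j ∈ partialSums 0 β.blocks then (1 : ℚ) else -1) *
          (if j ∈ partialSums 0 l then 2 else 1)) *
        ∏ j ∈ Finset.Ioo 0 N \ T, if j ∈ partialSums 0 β.blocks then (-1 : ℚ) else 2 := by
      intro T hT
      rw [map_smul, coeffAt_levelQSym (Finset.mem_powerset.1 hT) hl, if_pos hs,
        Finset.prod_mul_distrib, smul_eq_mul]
      ring
    rw [Finset.sum_congr rfl h, ← Finset.prod_add]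
    -- The factor of each level `j` tests whether `j` is a partial sum of both or of neither list.
    have h2 : ∀ j, (if j ∈ partialSums 0 β.blocks then (1 : ℚ) else -1) *
          (if j ∈ partialSums 0 l then 2 else 1) +
        (if j ∈ partialSums 0 β.blocks then (-1 : ℚ) else 2) =
        if (j ∈ partialSums 0 β.blocks ↔ j ∈ partialSums 0 l) then 1 else 0 := by
      intro j
      by_cases h1 : j ∈ partialSums 0 β.blocks <;> by_cases h2 : j ∈ partialSums 0 l <;>
        simp [h1, h2] <;> norm_num
    rw [Finset.prod_congr rfl fun j _ => h2 j]
    split_ifs with he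
    · rw [he]
      simp
    · by_contra hne
      have hne := fun j hj => Finset.prod_ne_zero_iff.1 (Ne.symm hne) j hj
      simp only [ne_eq, ite_eq_right_iff, one_ne_zero, imp_false, not_not] at hne
      apply he
      -- The levels outside the open interval carry no information: `N` is always a partial sum,
      -- unless `N = 0`.
      have hmem : ∀ b : List ℕ, (∀ a ∈ b, 0 < a) → b.sum = N → ∀ j, j ∉ Finset.Ioo 0 N →
          (j ∈ partialSums 0 b ↔ j = N ∧ 0 < N) := by
        intro b hb hbs j hj
        rw [Finset.mem_Ioo] at hj
        constructor
        · intro hm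
          have := bounds_of_mem_partialSums hb hm
          omega
        · rintro ⟨rfl, h0⟩
          have := add_sum_mem_partialSums (i := 0) (l := b) (by rintro rfl; simp at hbs; omega)
          rwa [zero_add, hbs] at this
      refine partialSums_injective (i := 0) hl hβ (Finset.ext fun j => ?_)
      by_cases hj : j ∈ Finset.Ioo 0 N
      · exact (hne j hj).symm
      · rw [hmem l hl hs j hj, hmem β.blocks hβ β.blocks_sum j hj]
  · rw [if_neg (by rintro rfl; exact hs β.blocks_sum), Finset.sum_eq_zero]
    intro T hT
    rw [map_smul, coeffAt_levelQSym (Finset.mem_powerset.1 hT) hl, if_neg hs, smul_zero]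

theorem linearMap_ext_posetQSym {V : Type*} [AddCommGroup V] [Module ℚ V] {φ ψ : QSym →ₗ[ℚ] V}
    (h : ∀ (P : Type) [PartialOrder P] [BoundedOrder P] [Fintype P] [GradeMinOrder ℕ P],
      φ (posetQSym P) = ψ (posetQSym P)) : φ = ψ := by
  refine linearMap_ext_monomial fun N β => ?_
  rw [monomialQSym_eq_sum_levelQSym, map_sum, map_sum]
  refine Finset.sum_congr rfl fun T hT => ?_
  rw [map_smul, map_smul]
  let _ := boundedOrder (Finset.mem_powerset.1 hT)
  exact congrArg _ (h (LevelPoset N T))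

theorem CountsElements.unique {G G' : QSym →ₗ[ℚ] ℚ} (h : CountsElements G)
    (h' : CountsElements G') : G = G' :=
  linearMap_ext_posetQSym fun P _ _ _ _ => (h P).trans (h' P).symm

theorem IsTchebyshevU.unique {G : QSym →ₗ[ℚ] ℚ} {U U' : QSym →ₗ[ℚ] QSym}
    (h : IsTchebyshevU G U) (h' : IsTchebyshevU G U') : U = U' :=
  linearMap_ext_posetQSym fun P _ _ _ _ => (h P).trans (h' P).symm

/-! ### Cutting and shuffling words -/

section Words

variable {C : Type*}

/-- The word `w` is the concatenation of words of lengths `a₁, …, a_k`, for `l = [a₁, …, a_k]`,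
each of which is `r`-increasing. -/
def CutsInto (r : C → C → Prop) (l : List ℕ) (w : List C) : Prop :=
  ∃ ws : List (List C), ws.flatten = w ∧ ws.map List.length = l ∧ ∀ u ∈ ws, u.Pairwise r

theorem cutsInto_nil {r : C → C → Prop} {w : List C} : CutsInto r [] w ↔ w = [] := by
  constructor
  · rintro ⟨ws, rfl, h, -⟩
    rw [List.map_eq_nil_iff.1 h]
    rfl
  · rintro rfl
    exact ⟨[], rfl, rfl, by simp⟩

theorem CutsInto.length_eq {r : C → C → Prop} {l : List ℕ} {w : List C} (h : CutsInto r l w) :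
    w.length = l.sum := by
  obtain ⟨ws, rfl, rfl, -⟩ := h
  exact List.length_flatten

theorem cutsInto_append {r : C → C → Prop} {l l' : List ℕ} {w : List C} :
    CutsInto r (l ++ l') w ↔ ∃ u v, u ++ v = w ∧ CutsInto r l u ∧ CutsInto r l' v := by
  constructor
  · rintro ⟨ws, rfl, h, hr⟩
    obtain ⟨us, vs, rfl, rfl, rfl⟩ := List.map_eq_append_iff.1 h
    exact ⟨us.flatten, vs.flatten, List.flatten_append.symm,
      ⟨us, rfl, rfl, fun u hu => hr u (List.mem_append_left _ hu)⟩,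
      ⟨vs, rfl, rfl, fun u hu => hr u (List.mem_append_right _ hu)⟩⟩
  · rintro ⟨_, _, rfl, ⟨us, rfl, rfl, h⟩, ⟨vs, rfl, rfl, h'⟩⟩
    exact ⟨us ++ vs, List.flatten_append, List.map_append, fun u hu =>
      (List.mem_append.1 hu).elim (h u) (h' u)⟩

theorem cutsInto_singleton {r : C → C → Prop} {a : ℕ} {w : List C} :
    CutsInto r [a] w ↔ w.length = a ∧ w.Pairwise r := by
  constructor
  · rintro ⟨ws, rfl, h, hr⟩
    obtain ⟨u, rfl, rfl⟩ := List.map_eq_singleton_iff.1 h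
    simpa using hr
  · rintro ⟨rfl, h⟩
    exact ⟨[w], by simp, rfl, by simpa using h⟩

theorem cutsInto_cons {r : C → C → Prop} {a : ℕ} {l : List ℕ} {w : List C} :
    CutsInto r (a :: l) w ↔ ∃ u v, u ++ v = w ∧ (u.length = a ∧ u.Pairwise r) ∧ CutsInto r l v := by
  rw [← List.singleton_append, cutsInto_append]
  simp only [cutsInto_singleton]

theorem cutsInto_filter {r : C → C → Prop} {l : List ℕ} {w : List C} :
    CutsInto r (l.filter (0 < ·)) w ↔ CutsInto r l w := by
  induction l generalizing w with
  | nil => rfl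
  | cons a l ih =>
    rw [List.filter_cons]
    split_ifs with ha
    · simp only [cutsInto_cons, ih]
    · simp only [decide_eq_true_eq, not_lt, nonpos_iff_eq_zero] at ha
      subst ha
      rw [ih, cutsInto_cons]
      constructor
      · intro h
        exact ⟨[], w, rfl, ⟨rfl, List.Pairwise.nil⟩, h⟩
      · rintro ⟨u, v, rfl, ⟨h, -⟩, h'⟩
        rwa [List.length_eq_zero_iff.1 h]

theorem CutsInto.reverse {r : C → C → Prop} {l : List ℕ} {w : List C} (h : CutsInto r l w) :
    CutsInto (fun a b => r b a) l.reverse w.reverse := by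
  obtain ⟨ws, rfl, rfl, h⟩ := h
  refine ⟨(ws.map List.reverse).reverse, List.reverse_flatten.symm, ?_, ?_⟩
  · rw [List.map_reverse, List.map_map]
    congr 2
    funext u
    simp
  · intro u hu
    simp only [List.mem_reverse, List.mem_map] at hu
    obtain ⟨v, hv, rfl⟩ := hu
    rw [List.pairwise_reverse]
    exact h v hv

theorem cutsInto_reverse {r : C → C → Prop} {l : List ℕ} {w : List C} :
    CutsInto (fun a b => r b a) l.reverse w.reverse ↔ CutsInto r l w :=
  ⟨fun h => by simpa using h.reverse, CutsInto.reverse⟩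

open Classical in
/-- The indicator of the words `w` that `CutsInto r l` admits and whose first piece has only
letters `c` with `r y c` for the bound `y`, if `x = some y`, computed letter by letter.  The bound
is the preceding letter of the same piece, and is forgotten where a new piece starts. -/
def cutIndicator (r : C → C → Prop) : Option C → List ℕ → List C → ℚ
  | _, [], w => if w = [] then 1 else 0
  | _, 0 :: l, w => cutIndicator r none l w
  | _, (_ + 1) :: _, [] => 0
  | x, (m + 1) :: l, a :: w =>
    if ∀ y ∈ x, r y a then cutIndicator r (some a) (m :: l) w else 0
  termination_by _ l _ => l.length + l.sum

open Classical in
theorem cutIndicator_eq (r : C → C → Prop) [IsTrans C r] (x : Option C) (l : List ℕ)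
    (w : List C) : cutIndicator r x l w =
      if ∃ ws : List (List C), ws.flatten = w ∧ ws.map List.length = l ∧
        (∀ u ∈ ws, u.Pairwise r) ∧ ∀ u ∈ ws.head?, ∀ y ∈ x, ∀ c ∈ u, r y c then 1 else 0 := by
  fun_induction cutIndicator r x l w with
  | case1 x =>
    rw [if_pos]
    exact ⟨[], by simp⟩
  | case2 x w hw =>
    rw [if_neg]
    rintro ⟨ws, rfl, h, -⟩
    rw [List.map_eq_nil_iff.1 h] at hw
    exact hw rfl
  | case3 x l w ih =>
    rw [ih]
    refine if_congr ?_ rfl rfl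
    constructor
    · rintro ⟨ws, rfl, rfl, h, -⟩
      exact ⟨[] :: ws, by simpa using h⟩
    · rintro ⟨ws, rfl, h, hr, -⟩
      obtain ⟨u, vs, rfl, hu, rfl⟩ := List.map_eq_cons_iff.1 h
      rw [List.length_eq_zero_iff] at hu
      subst hu
      exact ⟨vs, by simpa using hr⟩
  | case4 x m l =>
    rw [if_neg]
    rintro ⟨ws, hw, h, -⟩
    obtain ⟨u, vs, rfl, hu, rfl⟩ := List.map_eq_cons_iff.1 h
    rw [List.flatten_cons, List.append_eq_nil_iff] at hw
    rw [hw.1] at hu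
    simp at hu
  | case5 x m l a w hx ih =>
    rw [ih]
    refine if_congr ?_ rfl rfl
    constructor
    · rintro ⟨ws, rfl, h, hr, hb⟩
      obtain ⟨u, vs, rfl, hu, rfl⟩ := List.map_eq_cons_iff.1 h
      simp only [List.head?_cons, Option.mem_def, Option.some.injEq, forall_eq'] at hb
      refine ⟨(a :: u) :: vs, rfl, by simp [hu], ?_, ?_⟩
      · simp only [List.mem_cons, forall_eq_or_imp] at hr ⊢
        exact ⟨List.pairwise_cons.2 ⟨hb, hr.1⟩, hr.2⟩
      · simp only [List.head?_cons, Option.mem_def, Option.some.injEq, forall_eq',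
          List.mem_cons, forall_eq_or_imp]
        exact fun y hy => ⟨hx y hy, fun c hc => Trans.trans (hx y hy) (hb c hc)⟩
    · rintro ⟨ws, hw, h, hr, hb⟩
      obtain ⟨u, vs, rfl, hu, rfl⟩ := List.map_eq_cons_iff.1 h
      obtain ⟨b, u, rfl⟩ := List.exists_cons_of_length_eq_add_one hu
      rw [List.flatten_cons, List.cons_append, List.cons.injEq] at hw
      obtain ⟨rfl, rfl⟩ := hw
      simp only [List.mem_cons, forall_eq_or_imp, List.pairwise_cons] at hr
      refine ⟨u :: vs, rfl, by simpa using hu, ?_, ?_⟩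
      · simp only [List.mem_cons, forall_eq_or_imp]
        exact ⟨hr.1.2, hr.2⟩
      · simpa using hr.1.1
  | case6 x m l a w hx =>
    rw [if_neg]
    rintro ⟨ws, hw, h, hr, hb⟩
    obtain ⟨u, vs, rfl, hu, rfl⟩ := List.map_eq_cons_iff.1 h
    obtain ⟨b, u, rfl⟩ := List.exists_cons_of_length_eq_add_one hu
    rw [List.flatten_cons, List.cons_append, List.cons.injEq] at hw
    obtain ⟨rfl, rfl⟩ := hw
    simp only [List.head?_cons, Option.mem_def, Option.some.injEq, forall_eq',
      List.mem_cons, forall_eq_or_imp] at hb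
    exact hx fun y hy => (hb y hy).1

open Classical in
theorem cutIndicator_none (r : C → C → Prop) [IsTrans C r] (l : List ℕ) (w : List C) :
    cutIndicator r none l w = if CutsInto r l w then 1 else 0 := by
  rw [cutIndicator_eq]
  exact if_congr (by simp [CutsInto]) rfl rfl

/-- The shuffles of two words, with multiplicity. -/
def shuffles : List C → List C → Multiset (List C)
  | [], B => {B}
  | A, [] => {A}
  | a :: A, b :: B =>
    (shuffles A (b :: B)).map (a :: ·) + (shuffles (a :: A) B).map (b :: ·)
  termination_by A B => A.length + B.length

theorem shuffles_nil_left (B : List C) : shuffles [] B = {B} := by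
  rw [shuffles]

theorem shuffles_nil_right (A : List C) : shuffles A [] = {A} := by
  cases A with
  | nil => rw [shuffles]
  | cons a A =>
    rw [shuffles]
    simp

theorem shuffles_cons_cons (a b : C) (A B : List C) : shuffles (a :: A) (b :: B) =
    (shuffles A (b :: B)).map (a :: ·) + (shuffles (a :: A) B).map (b :: ·) := by
  rw [shuffles]

theorem shuffles_comm (A B : List C) : shuffles A B = shuffles B A := by
  fun_induction shuffles A B with
  | case1 B => rw [shuffles_nil_right]
  | case2 A => rw [shuffles_nil_left]
  | case3 a A b B ih1 ih2 => rw [shuffles_cons_cons, ih1, ih2, add_comm]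

theorem perm_of_mem_shuffles {A B w : List C} (h : w ∈ shuffles A B) : w.Perm (A ++ B) := by
  fun_induction shuffles A B generalizing w with
  | case1 B => rw [Multiset.mem_singleton.1 h, List.nil_append]
  | case2 A => rw [Multiset.mem_singleton.1 h, List.append_nil]
  | case3 a A b B ih1 ih2 =>
    rw [Multiset.mem_add, Multiset.mem_map, Multiset.mem_map] at h
    rcases h with ⟨v, hv, rfl⟩ | ⟨v, hv, rfl⟩
    · exact (ih1 hv).cons a
    · exact ((ih2 hv).cons b).trans List.perm_middle.symm

theorem sum_listAntidiagonal_swap {V : Type*} [AddCommMonoid V] (φ : List ℕ × List ℕ → V)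
    (l : List ℕ) : ∑ p ∈ listAntidiagonal l, φ p.swap = ∑ p ∈ listAntidiagonal l, φ p := by
  induction l generalizing φ with
  | nil => rw [sum_listAntidiagonal_nil, sum_listAntidiagonal_nil]; rfl
  | cons a l ih =>
    rw [sum_listAntidiagonal_cons, sum_listAntidiagonal_cons, ← Finset.Nat.sum_antidiagonal_swap]
    refine Finset.sum_congr rfl fun p _ => ?_
    rw [← ih]
    rfl

theorem sum_listAntidiagonal_reverse {V : Type*} [AddCommMonoid V] (φ : List ℕ × List ℕ → V)
    (l : List ℕ) : ∑ p ∈ listAntidiagonal l.reverse, φ p =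
      ∑ p ∈ listAntidiagonal l, φ (p.1.reverse, p.2.reverse) := by
  induction l generalizing φ with
  | nil => rw [List.reverse_nil, sum_listAntidiagonal_nil, sum_listAntidiagonal_nil]; rfl
  | cons a l ih =>
    rw [List.reverse_cons, sum_listAntidiagonal_append, sum_listAntidiagonal_cons, ih,
      Finset.sum_comm (s := Finset.HasAntidiagonal.antidiagonal a)]
    refine Finset.sum_congr rfl fun p _ => ?_
    rw [sum_listAntidiagonal_cons]
    simp [sum_listAntidiagonal_nil]

theorem sum_cutIndicator_nil_mul (r : C → C → Prop) (x : Option C) (l : List ℕ)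
    (φ : List ℕ → ℚ) :
    ∑ p ∈ listAntidiagonal l, cutIndicator r x p.1 [] * φ p.2 = φ l := by
  induction l generalizing x φ with
  | nil => simp [sum_listAntidiagonal_nil, cutIndicator]
  | cons a l ih =>
    rw [sum_listAntidiagonal_cons, Finset.sum_eq_single (0, a)]
    · simp only [cutIndicator]
      exact ih none fun q => φ (a :: q)
    · rintro ⟨i, j⟩ hp hne
      rw [Finset.HasAntidiagonal.mem_antidiagonal] at hp
      cases i with
      | zero => exact absurd (by simpa using hp) hne
      | succ i => simp [cutIndicator]
    · intro h
      simp at h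

/-- If `a` precedes `b`, the sum over the splittings `m + 1 = i + j` of the first part falls into
the terms with `i > 0`, where the merged word starts with `a`, and the term `i = 0`, where it starts
with `b`; a piece that starts with `b` can take no further letter from `a :: A`. -/
theorem sum_cutIndicator_cons_cons (r : C → C → Prop) [IsStrictTotalOrder C r] (x : Option C)
    (m : ℕ) (l : List ℕ) {a b : C} (hab : r a b) (A B : List C) [Decidable (∀ y ∈ x, r y a)]
    [Decidable (∀ y ∈ x, r y b)] :
    ∑ p ∈ listAntidiagonal ((m + 1) :: l),
        cutIndicator r x p.1 (a :: A) * cutIndicator r x p.2 (b :: B) =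
      (if ∀ y ∈ x, r y a then ∑ p ∈ listAntidiagonal (m :: l),
        cutIndicator r (some a) p.1 A * cutIndicator r (some a) p.2 (b :: B) else 0) +
      if ∀ y ∈ x, r y b then ∑ p ∈ listAntidiagonal (m :: l),
        cutIndicator r (some b) p.1 (a :: A) * cutIndicator r (some b) p.2 B else 0 := by
  rw [sum_listAntidiagonal_cons, Finset.Nat.antidiagonal_succ, Finset.sum_cons, add_comm]
  congr 1
  · rw [Finset.sum_map, sum_listAntidiagonal_cons]
    split_ifs with hx
    · refine Finset.sum_congr rfl fun p _ => Finset.sum_congr rfl fun q _ => ?_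
      obtain ⟨i, j⟩ := p
      have h1 : cutIndicator r x ((i + 1) :: q.1) (a :: A) =
          cutIndicator r (some a) (i :: q.1) A := by
        rw [cutIndicator, if_pos hx]
      have h2 : cutIndicator r x (j :: q.2) (b :: B) =
          cutIndicator r (some a) (j :: q.2) (b :: B) := by
        cases j with
        | zero => rw [cutIndicator, cutIndicator]
        | succ j =>
          rw [cutIndicator, cutIndicator, if_pos fun y hy => Trans.trans (hx y hy) hab,
            if_pos (by simpa using hab)]
      exact congrArg₂ _ h1 h2
    · refine Finset.sum_eq_zero fun p _ => Finset.sum_eq_zero fun q _ => ?_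
      obtain ⟨i, j⟩ := p
      have h1 : cutIndicator r x ((i + 1) :: q.1) (a :: A) = 0 := by
        rw [cutIndicator, if_neg hx]
      exact mul_eq_zero_of_left h1 _
  · rw [sum_listAntidiagonal_cons, Finset.sum_eq_single (0, m)]
    · simp only [cutIndicator]
      split_ifs with hx
      · rfl
      · simp
    · rintro ⟨i, j⟩ hp hne
      rw [Finset.HasAntidiagonal.mem_antidiagonal] at hp
      refine Finset.sum_eq_zero fun q _ => ?_
      cases i with
      | zero => exact absurd (by simpa using hp) hne
      | succ i =>
        rw [cutIndicator, if_neg, zero_mul]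
        intro h
        exact asymm_of r hab (h b rfl)
    · intro h
      simp at h

/-- The product rule for shuffles: reading a shuffle of `A` and `B` letter by letter, the letters
of a piece of length `m` are the merged letters of a piece of `A` and a piece of `B`, and there is
exactly one way to merge two increasing words without common letters into an increasing word. -/
theorem sum_cutIndicator_mul (r : C → C → Prop) [IsStrictTotalOrder C r] (l : List ℕ)
    (x : Option C) {A B : List C} (hAB : ∀ a ∈ A, ∀ b ∈ B, a ≠ b) :
    ∑ p ∈ listAntidiagonal l, cutIndicator r x p.1 A * cutIndicator r x p.2 B =
      ((shuffles A B).map (cutIndicator r x l)).sum := by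
  classical
  have nil_left : ∀ (l : List ℕ) (x : Option C) (B : List C),
      ∑ p ∈ listAntidiagonal l, cutIndicator r x p.1 [] * cutIndicator r x p.2 B =
        ((shuffles [] B).map (cutIndicator r x l)).sum := fun l x B => by
    rw [shuffles_nil_left, Multiset.map_singleton, Multiset.sum_singleton,
      sum_cutIndicator_nil_mul r x l (cutIndicator r x · B)]
  have comm : ∀ (l : List ℕ) (x : Option C) (A B : List C),
      ∑ p ∈ listAntidiagonal l, cutIndicator r x p.1 A * cutIndicator r x p.2 B =
        ∑ p ∈ listAntidiagonal l, cutIndicator r x p.1 B * cutIndicator r x p.2 A :=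
    fun l x A B => by
      rw [← sum_listAntidiagonal_swap]
      exact Finset.sum_congr rfl fun p _ => mul_comm _ _
  induction l generalizing x A B with
  | nil =>
    cases A with
    | nil => exact nil_left _ _ _
    | cons a A =>
      cases B with
      | nil => rw [comm, shuffles_comm]; exact nil_left _ _ _
      | cons b B =>
        simp [sum_listAntidiagonal_nil, cutIndicator, shuffles_cons_cons]
  | cons m l ihl =>
    induction m generalizing x A B with
    | zero =>
      rw [sum_listAntidiagonal_cons]
      simp only [Finset.Nat.antidiagonal_zero, Finset.sum_singleton, cutIndicator, ihl none hAB]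
    | succ m ihm =>
      cases A with
      | nil => exact nil_left _ _ _
      | cons a A =>
        cases B with
        | nil => rw [comm, shuffles_comm]; exact nil_left _ _ _
        | cons b B =>
          have hA := ihm (A := A) (B := b :: B) (some a)
            (fun c hc => hAB c (List.mem_cons_of_mem _ hc))
          have hB := ihm (A := a :: A) (B := B) (some b)
            (fun c hc d hd => hAB c hc d (List.mem_cons_of_mem _ hd))
          have hR : ((shuffles (a :: A) (b :: B)).map (cutIndicator r x ((m + 1) :: l))).sum =
              (if ∀ y ∈ x, r y a then
                ((shuffles A (b :: B)).map (cutIndicator r (some a) (m :: l))).sum else 0) +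
              if ∀ y ∈ x, r y b then
                ((shuffles (a :: A) B).map (cutIndicator r (some b) (m :: l))).sum else 0 := by
            rw [shuffles_cons_cons, Multiset.map_add, Multiset.sum_add, Multiset.map_map,
              Multiset.map_map]
            congr 1
            · split_ifs with hx
              · refine congrArg Multiset.sum (Multiset.map_congr rfl fun w _ => ?_)
                rw [Function.comp_apply, cutIndicator, if_pos hx]
              · refine Multiset.sum_eq_zero fun z hz => ?_
                obtain ⟨w, -, rfl⟩ := Multiset.mem_map.1 hz
                rw [Function.comp_apply, cutIndicator, if_neg hx]
            · split_ifs with hx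
              · refine congrArg Multiset.sum (Multiset.map_congr rfl fun w _ => ?_)
                rw [Function.comp_apply, cutIndicator, if_pos hx]
              · refine Multiset.sum_eq_zero fun z hz => ?_
                obtain ⟨w, -, rfl⟩ := Multiset.mem_map.1 hz
                rw [Function.comp_apply, cutIndicator, if_neg hx]
          rw [hR, ← hA, ← hB]
          rcases trichotomous_of r a b with h | h | h
          · exact sum_cutIndicator_cons_cons r x m l h A B
          · exact absurd h (hAB a (by simp) b (by simp))
          · rw [comm, sum_cutIndicator_cons_cons r x m l h B A, add_comm]
            congr 1
            · rw [comm]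
            · rw [comm]

end Words

/-! ### Fundamental functions of words -/

section FundamentalWords

variable {C : Type*} [LinearOrder C]

open Classical in
/-- The fundamental quasisymmetric function of the descent composition of a word `w` with distinct
letters: the coefficient of `x_0^{a₁} x_1^{a₂} ⋯` is `1` if `w` is a concatenation of increasing
words of lengths `a₁, a₂, …`, and `0` otherwise. -/
def wordQSym (w : List C) : QSym :=
  ⟨fun m => if CutsInto (· < ·) (exponentWord m) w then 1 else 0, by
    refine ⟨⟨w.length, fun m hm => ?_⟩, fun m m' h => ?_⟩
    · have h : CutsInto (· < ·) (exponentWord m) w := by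
        by_contra h
        exact hm (if_neg h)
      rw [← exponentWord_sum, h.length_eq]
    · change ite _ _ _ = ite _ _ _
      rw [h]⟩

open Classical in
theorem coeffAt_wordQSym (l : List ℕ) (w : List C) :
    coeffAt l (wordQSym w) = if CutsInto (· < ·) l w then 1 else 0 := by
  change ite _ _ _ = _
  rw [exponentWord_packedMonomial_filter, cutsInto_filter]

theorem comul_wordQSym (w : List C) :
    CoalgebraStruct.comul (R := ℚ) (wordQSym w) = ∑ c ∈ Finset.range (w.length + 1),
      wordQSym (w.take c) ⊗ₜ[ℚ] wordQSym (w.drop c) := by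
  classical
  refine tensor_ext fun l l' _ _ => ?_
  rw [convolution_apply_comul, convolution_coeffAt, map_sum, map_sum, coeffAt_wordQSym]
  simp only [TensorProduct.map_tmul, LinearMap.mul'_apply, coeffAt_wordQSym]
  by_cases h : CutsInto (· < ·) (l ++ l') w
  · rw [if_pos h]
    obtain ⟨u, v, rfl, hu, hv⟩ := cutsInto_append.1 h
    rw [Finset.sum_eq_single u.length]
    · rw [List.take_left', List.drop_left', if_pos hu, if_pos hv, mul_one] <;> rfl
    · intro c hc hne
      rw [if_neg, zero_mul]
      intro hh
      apply hne
      have h1 := hh.length_eq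
      rw [List.length_take, ← hu.length_eq] at h1
      rw [Finset.mem_range] at hc
      omega
    · intro hh
      exact absurd (by simp) hh
  · rw [if_neg h]
    refine (Finset.sum_eq_zero fun c _ => ?_).symm
    by_cases h1 : CutsInto (· < ·) l (w.take c)
    · rw [if_neg (fun h2 => h (cutsInto_append.2 ⟨_, _, List.take_append_drop c w, h1, h2⟩)),
        mul_zero]
    · rw [if_neg h1, zero_mul]

theorem wordQSym_mul {u v : List C} (huv : ∀ a ∈ u, ∀ b ∈ v, a ≠ b) :
    wordQSym u * wordQSym v =
      ((shuffles u.reverse v.reverse).map fun w => wordQSym w.reverse).sum := by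
  classical
  refine qsym_ext fun l _ => ?_
  have h : ∀ (l : List ℕ) (w : List C), coeffAt l (wordQSym w) =
      cutIndicator (fun a b => b < a) none l.reverse w.reverse := fun l w => by
    rw [coeffAt_wordQSym, cutIndicator_none]
    exact if_congr cutsInto_reverse.symm rfl rfl
  rw [coeffAt_mul, map_multiset_sum, Multiset.map_map]
  simp only [Function.comp_def, h, List.reverse_reverse]
  have : IsStrictTotalOrder C (fun a b => b < a) :=
    inferInstanceAs (IsStrictTotalOrder C (· > ·))
  rw [← sum_cutIndicator_mul (fun a b : C => b < a) l.reverse none (by simpa using huv),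
    sum_listAntidiagonal_reverse]

/-- The operator `id ⋆ id` on `𝒬`, the composite of the product with the coproduct. -/
def squareOperator : QSym →ₗ[ℚ] QSym := LinearMap.mul' ℚ QSym ∘ₗ CoalgebraStruct.comul

theorem psi_squareOperator (f : QSym) :
    psiAlgHom (squareOperator f) = squareOperator (psiAlgHom f) := by
  have h : ∀ z : QSym ⊗[ℚ] QSym, psiAlgHom (LinearMap.mul' ℚ QSym z) = LinearMap.mul' ℚ QSym
      (TensorProduct.map psiAlgHom.toLinearMap psiAlgHom.toLinearMap z) := by
    intro z
    induction z with
    | zero => simp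
    | tmul f g => simp
    | add x y hx hy => simp only [map_add, hx, hy]
  rw [squareOperator, LinearMap.comp_apply, h]
  exact congrArg (LinearMap.mul' ℚ QSym) (LinearMap.congr_fun psi_comul f)

theorem squareOperator_wordQSym (w : List C) :
    squareOperator (wordQSym w) = ∑ c ∈ Finset.range (w.length + 1),
      wordQSym (w.take c) * wordQSym (w.drop c) := by
  simp [squareOperator, comul_wordQSym]

open Classical in
theorem coeffAt_wordQSym_of_sorted {w : List C} (hw : w.Pairwise (· < ·)) (l : List ℕ) :
    coeffAt l (wordQSym w) = if l.sum = w.length then 1 else 0 := by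
  rw [coeffAt_wordQSym]
  refine if_congr ⟨fun h => h.length_eq.symm, ?_⟩ rfl rfl
  induction l generalizing w with
  | nil =>
    intro h
    rw [cutsInto_nil, List.length_eq_zero_iff.1 h.symm]
  | cons a l ih =>
    intro h
    rw [List.sum_cons] at h
    rw [cutsInto_cons]
    refine ⟨w.take a, w.drop a, List.take_append_drop a w, ⟨?_, hw.take⟩, ih hw.drop ?_⟩
    · rw [List.length_take]
      omega
    · rw [List.length_drop]
      omega

/-- On the complete homogeneous function `F_{(n)}`, the operators `Ψ₂` and `id ⋆ id` agree: both
give the function whose coefficient at `x_0^{a₁} x_1^{a₂} ⋯` is `(a₁ + 1)(a₂ + 1) ⋯`. -/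
theorem psi_wordQSym_of_sorted {w : List C} (hw : w.Pairwise (· < ·)) :
    psiAlgHom (wordQSym w) = squareOperator (wordQSym w) := by
  classical
  refine qsym_ext fun l _ => ?_
  rw [squareOperator_wordQSym, coeffAt_psi, map_sum]
  simp only [coeffAt_mul]
  rw [Finset.sum_comm]
  refine Finset.sum_congr rfl fun p hp => ?_
  have hlen := length_of_mem_listAntidiagonal hp
  rw [coeffAt_wordQSym_of_sorted hw, sum_interleave _ _ (hlen.1.trans hlen.2.symm)]
  have h : ∀ c ∈ Finset.range (w.length + 1),
      coeffAt p.1 (wordQSym (w.take c)) * coeffAt p.2 (wordQSym (w.drop c)) =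
        if c = p.1.sum then (if p.1.sum + p.2.sum = w.length then 1 else 0) else 0 := by
    intro c hc
    rw [Finset.mem_range] at hc
    rw [coeffAt_wordQSym_of_sorted hw.take, coeffAt_wordQSym_of_sorted hw.drop, List.length_take,
      List.length_drop, mul_ite, mul_one, mul_zero, ← ite_and, ← ite_and]
    refine if_congr ?_ rfl rfl
    omega
  rw [Finset.sum_congr rfl h, Finset.sum_ite_eq']
  split_ifs with h1 h2
  · rfl
  · rw [Finset.mem_range] at h2
    omega
  · simp
  · simp

theorem cutsInto_iff_getElem {l : List ℕ} {w : List C} (hl : l.sum = w.length) :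
    CutsInto (· < ·) l w ↔ ∀ (i : ℕ) (hi : i + 1 < w.length),
      (∀ j, (l.take j).sum ≠ i + 1) → w[i] < w[i + 1] := by
  induction l generalizing w with
  | nil =>
    have : w = [] := List.length_eq_zero_iff.1 hl.symm
    subst this
    simp [cutsInto_nil]
  | cons a l ih =>
    rw [List.sum_cons] at hl
    have hd : l.sum = (w.drop a).length := by
      rw [List.length_drop]
      omega
    constructor
    · intro h i hi hj
      obtain ⟨u, v, rfl, ⟨rfl, hu⟩, hv⟩ := cutsInto_cons.1 h
      have hne := hj 1
      simp only [List.take_succ_cons, List.take_zero, List.sum_cons, List.sum_nil,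
        add_zero] at hne
      rcases Nat.lt_or_ge (i + 1) u.length with h1 | h1
      · rw [List.getElem_append_left h1, List.getElem_append_left (by omega)]
        exact List.pairwise_iff_getElem.1 hu _ _ _ _ (Nat.lt_succ_self i)
      · rw [List.getElem_append_right (by omega), List.getElem_append_right (by omega)]
        have hv' := (ih (w := v) hv.length_eq.symm).1 hv (i - u.length)
          (by rw [List.length_append] at hi; omega) (fun j hj' => by
            have := hj (j + 1)
            rw [List.take_succ_cons, List.sum_cons, hj'] at this
            omega)
        convert hv' using 2
        omega
    · intro h
      refine cutsInto_cons.2 ⟨w.take a, w.drop a, List.take_append_drop a w, ⟨?_, ?_⟩,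
        (ih hd).2 ?_⟩
      · rw [List.length_take]
        omega
      · rw [← List.isChain_iff_pairwise, List.isChain_iff_getElem]
        intro i hi
        rw [List.length_take] at hi
        rw [List.getElem_take, List.getElem_take]
        refine h i (by omega) fun j hj => ?_
        cases j with
        | zero => simp at hj
        | succ j =>
          rw [List.take_succ_cons, List.sum_cons] at hj
          omega
      · intro i hi hj
        rw [List.length_drop] at hi
        have := h (a + i) (by omega) (fun j hj' => by
          cases j with
          | zero => simp at hj'
          | succ j =>
            rw [List.take_succ_cons, List.sum_cons] at hj'
            exact hj j (by omega))
        simpa [add_assoc] using this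

end FundamentalWords

theorem mem_boundaries_iff {n : ℕ} (α : Composition n) (i : Fin (n + 1)) :
    i ∈ α.boundaries ↔ ∃ j, (α.blocks.take j).sum = i := by
  simp only [Composition.boundaries, Finset.mem_map, Finset.mem_univ, true_and]
  constructor
  · rintro ⟨j, rfl⟩
    exact ⟨j, rfl⟩
  · rintro ⟨j, hj⟩
    rcases Nat.lt_or_ge j (α.length + 1) with h | h
    · exact ⟨⟨j, h⟩, Fin.ext hj⟩
    · refine ⟨Fin.last _, Fin.ext ?_⟩
      rw [← hj]
      change α.sizeUpTo α.length = α.sizeUpTo j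
      rw [α.sizeUpTo_length, α.sizeUpTo_ofLength_le j (by omega)]

theorem mem_boundaries_descentComposition {n : ℕ} (σ : Equiv.Perm (Fin n)) (i : Fin (n + 1)) :
    i ∈ (descentComposition σ).boundaries ↔
      i = 0 ∨ i = Fin.last n ∨ ∃ j ∈ descentSet σ, (i : ℕ) = j + 1 := by
  rw [descentComposition, CompositionAsSet.toComposition_boundaries]
  simp [compositionAsSetEquiv]

/-- The word of a permutation has the fundamental function of its descent composition. -/
theorem wordQSym_ofFn {n : ℕ} (σ : Equiv.Perm (Fin n)) :
    wordQSym (List.ofFn σ) = fundamentalQSym (descentComposition σ) := by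
  classical
  refine qsym_ext fun l hl => ?_
  by_cases hs : l.sum = n
  · subst hs
    let β : Composition l.sum := compositionOfList l hl
    have hβ : coeffAt l (fundamentalQSym (descentComposition σ)) = _ :=
      coeff_fundamentalQSym (descentComposition σ) β
    rw [hβ, coeffAt_wordQSym]
    refine if_congr ?_ rfl rfl
    rw [cutsInto_iff_getElem (by simp)]
    have hmem : ∀ i, i ∈ β.boundaries ↔ ∃ j, (l.take j).sum = i := mem_boundaries_iff β
    constructor
    · intro h i hi
      rcases (mem_boundaries_descentComposition σ i).1 hi with rfl | rfl | ⟨j, hj, hij⟩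
      · exact (hmem _).2 ⟨0, rfl⟩
      · exact (hmem _).2 ⟨l.length, by simp⟩
      · rw [hmem]
        by_contra hne
        push Not at hne
        have h1 := h j (by rw [List.length_ofFn]; omega) (fun k hk => hne k (by omega))
        rw [descentSet, Finset.mem_filter] at hj
        simp only [List.getElem_ofFn] at h1
        exact absurd hj.2 (not_lt.2 h1.le)
    · intro h i hi hj
      rw [List.length_ofFn] at hi
      simp only [List.getElem_ofFn]
      by_contra hlt
      have hne : σ ⟨i, by omega⟩ ≠ σ ⟨i + 1, hi⟩ := fun he => by
        have := congrArg Fin.val (σ.injective he)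
        simp at this
      have hd : (⟨i, by omega⟩ : Fin (l.sum - 1)) ∈ descentSet σ := by
        rw [descentSet, Finset.mem_filter]
        exact ⟨Finset.mem_univ _, lt_of_le_of_ne (not_lt.1 hlt) hne.symm⟩
      have hb := h ((mem_boundaries_descentComposition σ ⟨i + 1, by omega⟩).2
        (Or.inr (Or.inr ⟨_, hd, rfl⟩)))
      obtain ⟨k, hk⟩ := (hmem _).1 hb
      exact hj k hk
  · rw [coeffAt_wordQSym, if_neg fun h => hs (by simpa using h.length_eq.symm)]
    exact (coeff_fundamentalQSym_of_ne (descentComposition σ) (compositionOfList l hl)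
      (Ne.symm hs)).symm

theorem fundamentalQSym_rowComposition (n : ℕ) :
    fundamentalQSym (rowComposition n) = wordQSym (List.finRange n) := by
  classical
  refine qsym_ext fun l hl => ?_
  rw [coeffAt_wordQSym_of_sorted (List.pairwise_lt_finRange n), List.length_finRange]
  split_ifs with hs
  · subst hs
    refine (coeff_fundamentalQSym (rowComposition l.sum) (compositionOfList l hl)).trans
      (if_pos ?_)
    intro i hi
    rw [mem_boundaries_iff] at hi ⊢
    obtain ⟨j, hj⟩ := hi
    have hrow : (i : ℕ) = 0 ∨ (i : ℕ) = l.sum := by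
      rw [← hj]
      generalize l.sum = n
      cases n with
      | zero =>
        change (([] : List ℕ).take j).sum = 0 ∨ _
        simp
      | succ n =>
        change (([n + 1] : List ℕ).take j).sum = 0 ∨ (([n + 1] : List ℕ).take j).sum = n + 1
        cases j <;> simp
    rcases hrow with h | h
    · exact ⟨0, by rw [h]; rfl⟩
    · refine ⟨l.length, ?_⟩
      change (l.take l.length).sum = _
      rw [List.take_length, h]
  · exact coeff_fundamentalQSym_of_ne (rowComposition n) (compositionOfList l hl) (Ne.symm hs)

/-! ### Riffle shuffles -/

theorem pmf_map_apply_of_injective {α β : Type*} {f : α → β} (hf : Function.Injective f)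
    (p : PMF α) (a : α) : p.map f (f a) = p a := by
  rw [PMF.map_apply, tsum_eq_single a]
  · simp
  · intro b hb
    rw [if_neg]
    intro h
    exact hb (hf h).symm

open Classical in
/-- Every shuffle of the packets is equally likely to arise from dropping cards. -/
theorem choose_mul_dropCards {C : Type} (A B w : List C) :
    ((A.length + B.length).choose A.length : ENNReal) * dropCards A B w =
      ((shuffles A B).count w : ENNReal) := by
  fun_induction shuffles A B generalizing w with
  | case1 B =>
    rw [dropCards, PMF.pure_apply, Multiset.count_singleton]
    simp
  | case2 A =>
    have h : dropCards A [] = PMF.pure A := by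
      cases A with
      | nil => rw [dropCards]
      | cons a A => rw [dropCards]; simp
    rw [h, PMF.pure_apply, Multiset.count_singleton]
    simp
  | case3 a A b B ih1 ih2 =>
    have hd : dropCards (a :: A) (b :: B) w =
        ((A.length + 1 : ℕ) : ENNReal) / ((A.length + 1 + (B.length + 1) : ℕ) : ENNReal) *
          (dropCards A (b :: B)).map (a :: ·) w +
        ((B.length + 1 : ℕ) : ENNReal) / ((A.length + 1 + (B.length + 1) : ℕ) : ENNReal) *
          (dropCards (a :: A) B).map (b :: ·) w := by
      rw [dropCards, PMF.bind_apply, tsum_bool, add_comm]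
      rfl
    have hmap : ∀ (c : C) (p : PMF (List C)) (S : Multiset (List C)) (N : ENNReal),
        (∀ v, N * p v = (S.count v : ENNReal)) →
          N * p.map (c :: ·) w = ((S.map (c :: ·)).count w : ENNReal) := by
      intro c p S N h
      have hinj : Function.Injective (c :: · : List C → List C) := List.cons_injective
      by_cases hw : ∃ v, c :: v = w
      · obtain ⟨v, rfl⟩ := hw
        rw [pmf_map_apply_of_injective hinj, Multiset.count_map_eq_count' _ _ hinj, h]
      · have h0 : p.map (c :: ·) w = 0 := by
          rw [PMF.map_apply, ENNReal.tsum_eq_zero]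
          intro v
          exact if_neg fun h => hw ⟨v, h.symm⟩
        rw [h0, mul_zero, Multiset.count_eq_zero_of_notMem, Nat.cast_zero]
        intro hm
        obtain ⟨v, -, hv⟩ := Multiset.mem_map.1 hm
        exact hw ⟨v, hv⟩
    have hfrac : ∀ x y k m : ℕ, x * k = m * y → 0 < m →
        (x : ENNReal) * ((k : ENNReal) / (m : ENNReal)) = y := by
      intro x y k m h hm
      rw [← mul_div_assoc, ← Nat.cast_mul, h, Nat.cast_mul, mul_comm,
        ENNReal.mul_div_cancel_right (by simpa using hm.ne') (by finiteness)]
    have e1 : (A.length + 1 + (B.length + 1)).choose (A.length + 1) * (A.length + 1) =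
        (A.length + 1 + (B.length + 1)) * (A.length + (B.length + 1)).choose A.length := by
      have := Nat.add_one_mul_choose_eq (A.length + (B.length + 1)) A.length
      have e : A.length + 1 + (B.length + 1) = A.length + (B.length + 1) + 1 := by omega
      rw [e, this]
    have e2 : (A.length + 1 + (B.length + 1)).choose (A.length + 1) * (B.length + 1) =
        (A.length + 1 + (B.length + 1)) * (A.length + 1 + B.length).choose (A.length + 1) := by
      have := Nat.add_one_mul_choose_eq (A.length + 1 + B.length) B.length
      rw [Nat.choose_symm_add, Nat.choose_symm_add (a := A.length + 1)]
      exact this.symm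
    rw [hd, mul_add, ← mul_assoc, ← mul_assoc]
    simp only [List.length_cons] at ih1 ih2 ⊢
    rw [hfrac _ _ _ _ e1 (by omega), hfrac _ _ _ _ e2 (by omega), hmap a _ _ _ ih1,
      hmap b _ _ _ ih2, Multiset.count_add, Nat.cast_add]

open Classical in
/-- The number of ways to cut `deck` and to shuffle the two packets that lead to `w`. -/
def riffleWays {C : Type} (deck w : List C) : ℕ :=
  ∑ c ∈ Finset.range (deck.length + 1),
    (shuffles (deck.take c).reverse (deck.drop c).reverse).count w.reverse

theorem two_pow_mul_riffle {C : Type} (deck w : List C) :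
    (2 : ENNReal) ^ deck.length * riffle deck w = (riffleWays deck w : ENNReal) := by
  classical
  rw [riffle, PMF.bind_apply, tsum_fintype, riffleWays, Finset.mul_sum, Nat.cast_sum]
  refine (Fin.sum_univ_eq_sum_range (fun c => (2 : ENNReal) ^ deck.length *
    ((deck.length.choose c : ENNReal) / 2 ^ deck.length *
      (dropCards (deck.take c).reverse (deck.drop c).reverse).map List.reverse w))
    (deck.length + 1)).trans ?_
  refine Finset.sum_congr rfl fun c hc => ?_
  rw [Finset.mem_range] at hc
  have h := choose_mul_dropCards (deck.take c).reverse (deck.drop c).reverse w.reverse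
  rw [List.length_reverse, List.length_reverse, List.length_take, List.length_drop,
    min_eq_left (by omega), Nat.add_sub_cancel' (by omega)] at h
  have hr := pmf_map_apply_of_injective List.reverse_injective
    (dropCards (deck.take c).reverse (deck.drop c).reverse) w.reverse
  rw [List.reverse_reverse] at hr
  rw [hr, ← mul_assoc, ENNReal.mul_div_cancel (by simp) (by finiteness)]
  convert h

theorem perm_of_riffle_ne_zero {C : Type} {deck w : List C} (h : riffle deck w ≠ 0) :
    w.Perm deck := by
  classical
  have h1 : riffleWays deck w ≠ 0 := by
    have := two_pow_mul_riffle deck w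
    intro h0
    rw [h0, Nat.cast_zero, mul_eq_zero] at this
    rcases this with h' | h'
    · simp at h'
    · exact h h'
  obtain ⟨c, -, hc⟩ := Finset.exists_ne_zero_of_sum_ne_zero h1
  have hm := perm_of_mem_shuffles (Multiset.count_ne_zero.1 hc)
  have h2 : ((deck.take c).reverse ++ (deck.drop c).reverse).Perm deck := by
    refine ((List.reverse_perm _).append (List.reverse_perm _)).trans ?_
    rw [List.take_append_drop]
  exact (List.reverse_perm w).symm.trans (hm.trans h2)

theorem perm_of_riffles_ne_zero {C : Type} (k : ℕ) {deck w : List C} (h : riffles k deck w ≠ 0) :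
    w.Perm deck := by
  induction k generalizing w with
  | zero =>
    by_contra hne
    apply h
    rw [riffles, PMF.pure_apply, if_neg]
    rintro rfl
    exact hne (List.Perm.refl _)
  | succ k ih =>
    rw [riffles, PMF.bind_apply, Ne, ENNReal.tsum_eq_zero, not_forall] at h
    obtain ⟨v, hv⟩ := h
    exact (perm_of_riffle_ne_zero (right_ne_zero_of_mul hv)).trans (ih (left_ne_zero_of_mul hv))

theorem exists_eq_ofFn_of_perm_finRange {n : ℕ} {w : List (Fin n)}
    (h : w.Perm (List.finRange n)) : ∃ σ : Equiv.Perm (Fin n), w = List.ofFn σ := by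
  have hlen : w.length = n := by rw [h.length_eq, List.length_finRange]
  have hnd : w.Nodup := h.nodup_iff.2 (List.nodup_finRange n)
  refine ⟨Equiv.ofBijective (fun i => w.get (i.cast hlen.symm))
    ((Fintype.bijective_iff_injective_and_card _).2 ⟨fun i j hij => ?_, rfl⟩), ?_⟩
  · have := List.nodup_iff_injective_get.1 hnd hij
    simpa using this
  · refine List.ext_getElem (by simp [hlen]) fun i h1 h2 => ?_
    simp

theorem ofFn_perm_injective {n : ℕ} :
    Function.Injective fun σ : Equiv.Perm (Fin n) => List.ofFn σ := fun _ _ h =>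
  DFunLike.coe_injective (List.ofFn_injective h)

/-- The number of ways in which `k` riffle shuffles of the sorted deck lead to `σ`. -/
def rifflesWays {n : ℕ} : ℕ → Equiv.Perm (Fin n) → ℕ
  | 0, σ => if σ = 1 then 1 else 0
  | k + 1, σ => ∑ τ : Equiv.Perm (Fin n), rifflesWays k τ * riffleWays (List.ofFn τ) (List.ofFn σ)

theorem two_pow_mul_riffles {n : ℕ} (k : ℕ) (σ : Equiv.Perm (Fin n)) :
    (2 : ENNReal) ^ (n * k) * riffles k (List.finRange n) (List.ofFn σ) =
      (rifflesWays k σ : ENNReal) := by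
  classical
  induction k generalizing σ with
  | zero =>
    have h1 : List.ofFn σ = List.finRange n ↔ σ = 1 := by
      rw [← List.ofFn_id]
      exact ofFn_perm_injective.eq_iff (a := σ) (b := 1)
    rw [riffles, PMF.pure_apply, rifflesWays]
    simp [h1]
  | succ k ih =>
    rw [riffles, PMF.bind_apply, tsum_eq_sum (s := Finset.univ.image
      fun τ : Equiv.Perm (Fin n) => List.ofFn τ), Finset.sum_image fun _ _ _ _ h =>
      ofFn_perm_injective h, rifflesWays, Finset.mul_sum, Nat.cast_sum]
    · refine Finset.sum_congr rfl fun τ _ => ?_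
      have h2 := two_pow_mul_riffle (List.ofFn τ) (List.ofFn σ)
      rw [List.length_ofFn] at h2
      rw [Nat.cast_mul, ← ih, ← h2, Nat.mul_succ, pow_add]
      ring
    · intro w hw
      by_contra hne
      obtain ⟨τ, rfl⟩ := exists_eq_ofFn_of_perm_finRange
        (perm_of_riffles_ne_zero k (left_ne_zero_of_mul hne))
      exact hw (Finset.mem_image_of_mem _ (Finset.mem_univ τ))

open Classical in
theorem multiset_sum_map_eq_sum_count {α ι V : Type*} [AddCommMonoid V] [Fintype ι] {e : ι → α}
    (he : Function.Injective e) (S : Multiset α) (hS : ∀ a ∈ S, ∃ i, e i = a) (g : α → V) :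
    (S.map g).sum = ∑ i, S.count (e i) • g (e i) := by
  rw [Finset.sum_multiset_map_count, ← Finset.sum_image (s := Finset.univ) (g := e)
    (f := fun a => S.count a • g a) fun _ _ _ _ h => he h]
  refine Finset.sum_subset (fun a ha => ?_) fun a _ ha => ?_
  · obtain ⟨i, rfl⟩ := hS a (Multiset.mem_toFinset.1 ha)
    exact Finset.mem_image_of_mem _ (Finset.mem_univ i)
  · rw [Multiset.count_eq_zero_of_notMem (fun h => ha (Multiset.mem_toFinset.2 h)), zero_smul]

/-- A riffle shuffle acts on fundamental functions as `id ⋆ id`: the coproduct cuts the deck and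
the product shuffles the packets. -/
theorem squareOperator_wordQSym_ofFn {n : ℕ} (τ : Equiv.Perm (Fin n)) :
    squareOperator (wordQSym (List.ofFn τ)) = ∑ σ : Equiv.Perm (Fin n),
      riffleWays (List.ofFn τ) (List.ofFn σ) • wordQSym (List.ofFn σ) := by
  classical
  have hnd : (List.ofFn τ).Nodup := List.nodup_ofFn.2 τ.injective
  have hperm : (List.ofFn τ).Perm (List.finRange n) := by
    rw [List.perm_ext_iff_of_nodup hnd (List.nodup_finRange n)]
    intro a
    simpa using ⟨τ.symm a, by simp⟩
  rw [squareOperator_wordQSym]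
  simp only [riffleWays, Finset.sum_smul]
  rw [Finset.sum_comm]
  refine Finset.sum_congr rfl fun c _ => ?_
  rw [wordQSym_mul, multiset_sum_map_eq_sum_count
    (e := fun σ : Equiv.Perm (Fin n) => (List.ofFn σ).reverse)
    (fun σ σ' h => ofFn_perm_injective (List.reverse_injective h))]
  · simp only [List.reverse_reverse]
    refine Finset.sum_congr rfl fun σ _ => ?_
    congr!
  · intro w hw
    have h1 := perm_of_mem_shuffles hw
    have h2 : ((List.ofFn τ |>.take c).reverse ++ ((List.ofFn τ).drop c).reverse).Perm
        (List.ofFn τ) := by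
      refine ((List.reverse_perm _).append (List.reverse_perm _)).trans ?_
      rw [List.take_append_drop]
    obtain ⟨σ, hσ⟩ := exists_eq_ofFn_of_perm_finRange
      ((List.reverse_perm w).trans (h1.trans (h2.trans hperm)))
    exact ⟨σ, by rw [← hσ, List.reverse_reverse]⟩
  · intro a ha b hb hab
    rw [← List.take_append_drop c (List.ofFn τ), List.nodup_append] at hnd
    exact hnd.2.2 a ha b hb hab

/-- Since `Ψ₂` commutes with `id ⋆ id` and agrees with it on `F_{(n)}`, so do their powers. -/
theorem psi_pow_fundamentalQSym_row (n k : ℕ) :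
    (psiAlgHom.toLinearMap ^ k) (fundamentalQSym (rowComposition n)) =
      ∑ σ : Equiv.Perm (Fin n), rifflesWays k σ • fundamentalQSym (descentComposition σ) := by
  simp only [← wordQSym_ofFn]
  rw [fundamentalQSym_rowComposition]
  induction k with
  | zero =>
    have h1 : List.ofFn (1 : Equiv.Perm (Fin n)) = List.finRange n := List.ofFn_id n
    simp [rifflesWays, ← h1]
  | succ k ih =>
    have hcomm : ∀ f, (psiAlgHom.toLinearMap ^ k) (squareOperator f) =
        squareOperator ((psiAlgHom.toLinearMap ^ k) f) := by
      intro f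
      clear ih
      induction k with
      | zero => simp
      | succ k ihk =>
        rw [pow_succ', Module.End.mul_apply, Module.End.mul_apply, ihk]
        exact psi_squareOperator _
    rw [pow_succ, Module.End.mul_apply, AlgHom.toLinearMap_apply,
      psi_wordQSym_of_sorted (List.pairwise_lt_finRange n), hcomm, ih, map_sum]
    simp only [map_nsmul, squareOperator_wordQSym_ofFn, rifflesWays, Finset.sum_smul,
      Finset.smul_sum, mul_smul]
    rw [Finset.sum_comm]

theorem fundamentalBasis_apply (a : Σ n : ℕ, Composition n) :
    fundamentalBasis a = fundamentalQSym a.2 := by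
  simp [fundamentalBasis]

theorem repr_psi_pow_eq_riffleDescentProb (n k : ℕ) (α : Composition n) :
    ((fundamentalBasis.repr (((1 : ℚ) / 2 ^ (n * k)) •
        (psiAlgHom.toLinearMap ^ k) (fundamentalQSym (rowComposition n))) ⟨n, α⟩ : ℚ) : ℝ) =
      (riffleDescentProb n k α).toReal := by
  have hprob : ∀ σ : Equiv.Perm (Fin n), (riffles k (List.finRange n) (List.ofFn σ)).toReal =
      (rifflesWays k σ : ℝ) / 2 ^ (n * k) := by
    intro σ
    have := congrArg ENNReal.toReal (two_pow_mul_riffles k σ)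
    rw [ENNReal.toReal_mul, ENNReal.toReal_pow, ENNReal.toReal_ofNat, ENNReal.toReal_natCast]
      at this
    rw [← this]
    field_simp
  have hrepr : ∀ σ : Equiv.Perm (Fin n),
      fundamentalBasis.repr (fundamentalQSym (descentComposition σ)) ⟨n, α⟩ =
        if descentComposition σ = α then 1 else 0 := by
    intro σ
    rw [← fundamentalBasis_apply ⟨n, descentComposition σ⟩, Module.Basis.repr_self,
      Finsupp.single_apply]
    simp
  rw [riffleDescentProb, ENNReal.toReal_sum fun σ _ => PMF.apply_ne_top _ _,
    psi_pow_fundamentalQSym_row]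
  simp only [hprob, map_smul, map_sum, map_nsmul, Finsupp.smul_apply, Finsupp.finsetSum_apply,
    hrepr]
  rw [Finset.sum_filter, smul_eq_mul, Finset.mul_sum]
  push_cast
  refine Finset.sum_congr rfl fun σ _ => ?_
  split_ifs
  · simp
    ring
  · simp

end

theorem corollary6 :
    ∃ (Ψ₂ : QSym →ₐc[ℚ] QSym) (G : QSym →ₐ[ℚ] ℚ) (U : QSym →ₗ[ℚ] QSym),
      (IsPsiTwo Ψ₂ ∧ ∀ Φ : QSym →ₐc[ℚ] QSym, IsPsiTwo Φ → Φ = Ψ₂) ∧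
      (CountsElements G.toLinearMap ∧
        ∀ G' : QSym →ₗ[ℚ] ℚ, CountsElements G' → G' = G.toLinearMap) ∧
      (IsTchebyshevU G.toLinearMap U ∧
        ∀ U' : QSym →ₗ[ℚ] QSym, IsTchebyshevU G.toLinearMap U' → U' = U) ∧
      (∀ f : QSym, U f = Ψ₂ f) ∧
      ∀ (n k : ℕ) (α : Composition n),
        ((fundamentalBasis.repr
            (((1 : ℚ) / 2 ^ (n * k)) • (U ^ k) (fundamentalQSym (rowComposition n))) ⟨n, α⟩ : ℚ) : ℝ)
          = (riffleDescentProb n k α).toReal :=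
  ⟨psiTwo, characterSquare, psiAlgHom.toLinearMap,
    ⟨isPsiTwo_psiTwo, fun _ h => h.unique isPsiTwo_psiTwo⟩,
    ⟨countsElements_characterSquare, fun _ h => h.unique countsElements_characterSquare⟩,
    ⟨isTchebyshevU_psi, fun _ h => h.unique isTchebyshevU_psi⟩,
    fun _ => rfl, repr_psi_pow_eq_riffleDescentProb⟩
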